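/- Let $\mathbb K$ be a field and let $\mathbb V$ be a groupoid. A (reduced) $\mathbb V$-module $E$ is a functor $(\bigsqcup_{k}\mathbb V^{k})^{op}\times\mathbb V\to \mathrm{dgVect}_{\mathbb K}$, $(v_1,\dots,v_k;v)\mapsto E\binom{v}{v_1,\dots,v_k}$, that vanishes for $k=0$; $E^{f_{\mathbb V}}$ is the underlying $ob(\mathbb V)$-coloured module, without the action of $\mathbb V$. A shuffle tree is a rooted tree with at least one vertex, edges coloured by $ob(\mathbb V)$ and labelled leaves, in which the inputs of every vertex are ordered by the smallest leaf of their subtrees. The free (non-unital) $ob(\mathbb V)$-coloured shuffle operad $F_{sh}^{ob(\mathbb V)}(E^{f_{\mathbb V}})$ is the sum over all shuffle trees $T$ of $\bigotimes_{w\in Vt(T)}E(w)$, with the grafting of trees as partial shuffle compositions $\circ_\varphi$, Koszul signs and the induced differential. Let $N\subseteq\mathbb V$ be a subgroupoid that contains all automorphisms of all objects, such that for every object $x$ there are only finitely many morphisms of $N$ with source $x$. (If $N$ consists of all automorphisms, this says that all groups $Aut(v)$ are finite; if $N=\mathbb V$, that moreover the components of $\mathbb V$ have finitely many objects.) A morphism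 $g:y'\to y$ of $N$ acts on an internal edge: it identifies the tree in which the upper vertex of the edge is $\alpha\cdot g$ (with $g$ acting on the relevant input of $\alpha$) and the lower vertex is $\beta$ with the tree in which they are $\alpha$ and $g\cdot\beta$. The free $\mathbb V$-coloured shuffle operad $F_{sh}^{\mathbb V}(E)$ is the sum over all shuffle trees of the coinvariants $\bigl[\bigotimes_{w}E(w)\bigr]_{Edges(T)}$ with respect to this action on all internal edges, with $\mathbb V$ acting at the leaves and at the root. For a $\mathbb V$-coloured shuffle operad $P$, let $P^{f_{\mathbb V}}$ be the $ob(\mathbb V)$-coloured shuffle operad obtained by forgetting the action of $\mathbb V$. Ideals are subcomplexes closed under composition with arbitrary elements and, in a $\mathbb V$-coloured operad, under the action of $\mathbb V$; $\langle X\rangle$ is the smallest ideal that contains $X$. Let $S\subseteq E$ be a set of homogeneous elements that spans $E$ and is stable under $\mathbb V$ (for example all homogeneous elements). An $ob(\mathbb V)$-coloured tree monomial is a shuffle tree whose vertices are decorated by elements of $S$, and a $\mathbb V$-coloured tree monomial is a class $[T]$ of these under the action on internal edges. Let the $ob(\mathbb V)$-coloured tree monomials (of each profile and degree) be totally ordered,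 and let $[T]_*$ be the smallest element of the finite class $[T]$. For $r=\sum_i k_i[T_i]\in F_{sh}^{\mathbb V}(E)$ write $[r]_*:=\sum_i k_i[T_i]_*\in F_{sh}^{ob(\mathbb V)}(E^{f_{\mathbb V}})$ (if $r$ has several expressions as a linear combination of classes, any choice of one is allowed). Put $$E_*^2:=\{\alpha\circ_\varphi\beta-[\alpha\circ_\varphi\beta]_*:\ \alpha,\beta\in S\},$$ where $\varphi$ runs over all partial shuffle compositions of $\alpha$ and $\beta$. 1. If $P=F_{sh}^{\mathbb V}(E)$ is free, then $P^{f_{\mathbb V}}$ is isomorphic, as an $ob(\mathbb V)$-coloured shuffle operad, to $$F_{sh}^{ob(\mathbb V)}(E^{f_{\mathbb V}})/\langle E_*^2\rangle .$$ 2. If $P=F_{sh}^{\mathbb V}(E)/\langle R\rangle$, where $R$ is a set of homogeneous elements whose linear span is stable under the action of $\mathbb V$, then $P^{f_{\mathbb V}}$ is isomorphic, as an $ob(\mathbb V)$-coloured shuffle operad, to $$F_{sh}^{ob(\mathbb V)}(E^{f_{\mathbb V}})/\langle E_*^2\sqcup R_*\rangle,\qquad R_*:=\{[r]_*: r\in R\}.$$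 -/

import Mathlib

open CategoryTheory

universe u v w k

namespace ShuffleOp

/-! ### Profiles, shuffles and shuffle compositions -/

/-- A morphism of profiles in `V^k`: a tuple of morphisms between the entries of two lists. -/
inductive Homs {V : Type u} [Groupoid.{v} V] : List V → List V → Type (max u v)
  | nil : Homs [] []
  | cons {x y : V} {l m : List V} (f : x ⟶ y) (fs : Homs l m) : Homs (x :: l) (y :: m)

/-- The identity morphism of a profile. -/
def Homs.id {V : Type u} [Groupoid.{v} V] : (l : List V) → Homs l l
  | [] => .nil
  | x :: l => .cons (𝟙 x) (Homs.id l)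

/-- Composition of morphisms of profiles. -/
def Homs.comp {V : Type u} [Groupoid.{v} V] : {l m n : List V} → Homs l m → Homs m n → Homs l n
  | _, _, _, .nil, .nil => .nil
  | _, _, _, .cons f fs, .cons g gs => .cons (f ≫ g) (fs.comp gs)

/-- `Shuffle l m n` is the type of the ways to write `n` as a shuffle (an interleaving) of the
lists `l` and `m`. -/
inductive Shuffle {C : Type u} : List C → List C → List C → Type u
  | nil : Shuffle [] [] []
  | left {l m n : List C} (x : C) (s : Shuffle l m n) : Shuffle (x :: l) m (x :: n)
  | right {l m n : List C} (x : C) (s : Shuffle l m n) : Shuffle l (x :: m) (x :: n)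

/-- `Graft c x b a` is the type of the partial shuffle compositions `∘_{i,σ}` of an operation with
inputs `c` and an operation with inputs `b` and output `x = cᵢ`, for which the composite has inputs
`a`. The first input of the lower operation takes the place `i`, and the other inputs of the lower
operation are shuffled with the inputs `c_{i+1}, c_{i+2}, …` of the upper one; that is, `σ` is a
shuffle permutation: it fixes `1, …, i` and is increasing on the other inputs of each of the two
operations. -/
inductive Graft {C : Type u} : List C → C → List C → List C → Type u
  | here {c b a : List C} (x y : C) (s : Shuffle c b a) : Graft (x :: c) x (y :: b) (y :: a)
  | there {c b a : List C} {x : C} (y : C) (φ : Graft c x b a) : Graft (y :: c) x b (y :: a)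

namespace Shuffle

variable {C : Type u}

/-- Exchange of the two parts of a shuffle. -/
def symm : {l m n : List C} → Shuffle l m n → Shuffle m l n
  | _, _, _, nil => nil
  | _, _, _, left x s => right x s.symm
  | _, _, _, right x s => left x s.symm

/-- Rebracketing of a shuffle of three lists `l`, `m`, `k` from `(l, m), k` to `(l, k), m`. -/
def assocL : {l m n k p : List C} → Shuffle l m n → Shuffle n k p →
    (l' : List C) × Shuffle l k l' × Shuffle l' m p
  | _, _, _, _, _, nil, nil => ⟨_, nil, nil⟩
  | _, _, _, _, _, s, right x t => ⟨_, right x (assocL s t).2.1, left x (assocL s t).2.2⟩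
  | _, _, _, _, _, left x s, left _ t => ⟨_, left x (assocL s t).2.1, left x (assocL s t).2.2⟩
  | _, _, _, _, _, right x s, left _ t => ⟨_, (assocL s t).2.1, right x (assocL s t).2.2⟩

/-- Rebracketing of a shuffle of three lists `l`, `m`, `k` from `(l, m), k` to `l, (m, k)`. -/
def assocR : {l m n k p : List C} → Shuffle l m n → Shuffle n k p →
    (m' : List C) × Shuffle m k m' × Shuffle l m' p
  | _, _, _, _, _, nil, nil => ⟨_, nil, nil⟩
  | _, _, _, _, _, s, right x t => ⟨_, right x (assocR s t).2.1, right x (assocR s t).2.2⟩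
  | _, _, _, _, _, left x s, left _ t => ⟨_, (assocR s t).2.1, left x (assocR s t).2.2⟩
  | _, _, _, _, _, right x s, left _ t => ⟨_, left x (assocR s t).2.1, right x (assocR s t).2.2⟩

/-- A composition into an entry of a shuffle `n` of `l` and `m` is a composition into an entry of
`l` or a composition into an entry of `m`. -/
def split : {l m n b n' : List C} → {x : C} → Shuffle l m n → Graft n x b n' →
    ((l' : List C) × Graft l x b l' × Shuffle l' m n') ⊕
      ((m' : List C) × Graft m x b m' × Shuffle l m' n')
  | _, _, _, _, _, _, left _ s, .here x y t =>
      .inl ⟨_, .here x y (s.assocL t).2.1, left y (s.assocL t).2.2⟩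
  | _, _, _, _, _, _, right _ s, .here x y t =>
      .inr ⟨_, .here x y (s.assocR t).2.1, right y (s.assocR t).2.2⟩
  | _, _, _, _, _, _, left _ s, .there y φ =>
    match split s φ with
    | .inl r => .inl ⟨_, .there y r.2.1, left y r.2.2⟩
    | .inr r => .inr ⟨_, r.2.1, left y r.2.2⟩
  | _, _, _, _, _, _, right _ s, .there y φ =>
    match split s φ with
    | .inl r => .inl ⟨_, r.2.1, right y r.2.2⟩
    | .inr r => .inr ⟨_, .there y r.2.1, right y r.2.2⟩

/-- Restriction of a morphism of profiles to the two parts of a shuffle. -/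
def pull {V : Type u} [Groupoid.{v} V] : {l m n n' : List V} → Shuffle l m n → Homs n' n →
    (l' : List V) × (m' : List V) × Shuffle l' m' n' × Homs l' l × Homs m' m
  | _, _, _, _, nil, .nil => ⟨_, _, nil, .nil, .nil⟩
  | _, _, _, _, left _ s, .cons (x := x') f fs =>
      let r := pull s fs
      ⟨_, _, left x' r.2.2.1, .cons f r.2.2.2.1, r.2.2.2.2⟩
  | _, _, _, _, right _ s, .cons (x := x') f fs =>
      let r := pull s fs
      ⟨_, _, right x' r.2.2.1, r.2.2.2.1, .cons f r.2.2.2.2⟩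

end Shuffle

/-! ### Modules -/

/-- A reduced (non-symmetric) `C`-coloured module in differential graded vector spaces:
`obj (c₁, …, cₙ) x` is a complex, with component `obj (c₁, …, cₙ) x i` in degree `i`. -/
structure ColouredModule (K : Type k) [Field K] (C : Type u) where
  obj : List C → C → ℤ → Type w
  [acg : ∀ c x n, AddCommGroup (obj c x n)]
  [mod : ∀ c x n, Module K (obj c x n)]
  d : ∀ {c x n}, obj c x n →ₗ[K] obj c x (n + 1)
  d_d : ∀ {c x n} (e : obj c x n), d (d e) = 0
  reduced : ∀ x n, Subsingleton (obj [] x n)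

attribute [instance] ColouredModule.acg ColouredModule.mod

/-- A reduced `V`-module for a groupoid `V`: a functor from `(⨆ₖ Vᵏ)ᵒᵖ × V` to differential graded
vector spaces. The projection `toColouredModule` forgets the action of `V`. -/
structure GroupoidModule (K : Type k) [Field K] (V : Type u) [Groupoid.{v} V] extends
    ColouredModule.{u, w} K V where
  act : ∀ {c c' x x' n}, Homs c' c → (x ⟶ x') → (obj c x n →ₗ[K] obj c' x' n)
  act_id : ∀ {c x n} (e : obj c x n), act (Homs.id c) (𝟙 x) e = e
  act_comp : ∀ {c c' c'' x x' x'' n} (f' : Homs c'' c') (f : Homs c' c) (h : x ⟶ x')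
    (h' : x' ⟶ x'') (e : obj c x n), act f' h' (act f h e) = act (f'.comp f) (h ≫ h') e
  act_d : ∀ {c c' x x' n} (f : Homs c' c) (h : x ⟶ x') (e : obj c x n),
    act f h (d e) = d (act f h e)

/-! ### Decorated shuffle trees -/

section Trees

variable {K : Type k} [Field K] {C : Type u}

/-- `Forest M c a n` is the type of the lists of shuffle trees with root colours `c` (a tree may be
a bare leaf), whose leaves, in the order of their labels, have the colours `a`, and whose vertices
are decorated by homogeneous elements of `M` of total degree `n`. The trees are listed by their
smallest leaf. In `graft e G F s h`, the first tree has the root vertex `e`, the trees at the inputs of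
`e` are `G`, the other trees of the list are `F`, and the smallest leaf `y` of the first tree is the
smallest leaf of all, while the other leaves `b` of the first tree are shuffled with those of `F`.
So every vertex lists its inputs by the smallest leaf of their subtrees, and every shuffle tree has
exactly one such description. -/
inductive Forest (M : ColouredModule.{u, w} K C) : List C → List C → ℤ → Type (max u w)
  | nil : Forest M [] [] 0
  | leaf {c a : List C} {n : ℤ} (x : C) (F : Forest M c a n) : Forest M (x :: c) (x :: a) n
  | graft {c c' a b a' : List C} {x y : C} {p q r n : ℤ} (e : M.obj c x p)
      (G : Forest M c (y :: b) q) (F : Forest M c' a r) (s : Shuffle b a a') (h : p + q + r = n) :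
      Forest M (x :: c') (y :: a') n

/-- `Tree M a x n` is the type of the shuffle trees with at least one vertex, leaves of the colours
`a` and root colour `x`, with decorations in `M` of total degree `n`. -/
inductive Tree (M : ColouredModule.{u, w} K C) : List C → C → ℤ → Type (max u w)
  | node {c a : List C} {x : C} {p q n : ℤ} (e : M.obj c x p) (F : Forest M c a q)
    (h : p + q = n) : Tree M a x n

variable {M : ColouredModule.{u, w} K C}

/-- The forest of bare leaves. -/
def Forest.leaves : (c : List C) → Forest M c c 0
  | [] => .nil
  | x :: c => .leaf x (Forest.leaves c)

/-- The tree with the single vertex `e`. -/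
def Tree.corolla {c : List C} {x : C} {p : ℤ} (e : M.obj c x p) : Tree M c x p :=
  .node e (Forest.leaves c) (add_zero p)

/-- Grafting of a tree onto a leaf of a forest. -/
def Forest.comp : {c a b a' : List C} → {x : C} → {p q n : ℤ} → Forest M c a p →
    Graft a x b a' → Tree M b x q → p + q = n → Forest M c a' n
  | _, _, _, _, _, _, _, _, .leaf _ F, .here _ _ s, .node e G _, _ =>
      .graft e G F s.symm (by omega)
  | _, _, _, _, _, _, _, _, .leaf y F, .there _ φ, T, hn => .leaf y (F.comp φ T hn)
  | _, _, _, _, _, _, _, _, .graft (y := x) e G F s _, .here _ y t, T, _ =>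
      .graft e (G.comp (.here x y (s.assocL t).2.1) T rfl) F (s.assocL t).2.2 (by omega)
  | _, _, _, _, _, _, _, _, .graft (y := y) e G F s _, .there _ φ, T, _ =>
      match s.split φ with
      | .inl r => .graft e (G.comp (.there y r.2.1) T rfl) F r.2.2 (by omega)
      | .inr r => .graft e G (F.comp r.2.1 T rfl) r.2.2 (by omega)

/-- The total degree of the vertices that come after a given leaf in the planar (depth first)
order. -/
def Forest.after : {c a b a' : List C} → {x : C} → {p : ℤ} → Forest M c a p → Graft a x b a' → ℤ
  | _, _, _, _, _, p, .leaf _ _, .here _ _ _ => p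
  | _, _, _, _, _, _, .leaf _ F, .there _ φ => F.after φ
  | _, _, _, _, _, _, .graft (y := x) (r := r) _ G _ s _, .here _ y t =>
      G.after (.here x y (s.assocL t).2.1) + r
  | _, _, _, _, _, _, .graft (y := y) (r := r) _ G F s _, .there _ φ =>
      match s.split φ with
      | .inl r' => G.after (.there y r'.2.1) + r
      | .inr r' => F.after r'.2.1

/-- Grafting of a tree onto a leaf of a tree. -/
def Tree.comp {a b a' : List C} {x z : C} {p q n : ℤ} :
    Tree M a z p → Graft a x b a' → Tree M b x q → p + q = n → Tree M a' z n
  | .node e F _, φ, T, _ => .node e (F.comp φ T rfl) (by omega)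

/-- The total degree of the vertices that come after a given leaf of a tree. -/
def Tree.after {a b a' : List C} {x z : C} {p : ℤ} : Tree M a z p → Graft a x b a' → ℤ
  | .node _ F _, φ => F.after φ

/-- The sign `(-1)ⁿ`. -/
def sgn (K : Type k) [Field K] (n : ℤ) : K := ((n.negOnePow : ℤ) : K)

/-- The differential of a decorated forest: the decorations are differentiated one after the other,
with the Koszul sign for the planar order of the vertices. -/
noncomputable def Forest.dTree :
    {c a : List C} → {n : ℤ} → Forest M c a n → (Forest M c a (n + 1) →₀ K)
  | _, _, _, .nil => 0
  | _, _, _, .leaf x F => F.dTree.mapDomain (.leaf x)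
  | _, _, _, .graft (p := p) (q := q) e G F s h =>
      .single (.graft (M.d e) G F s (by omega)) 1
        + sgn K p • G.dTree.mapDomain (fun G' => .graft e G' F s (by omega))
        + sgn K (p + q) • F.dTree.mapDomain (fun F' => .graft e G F' s (by omega))

/-- The differential of a decorated tree. -/
noncomputable def Tree.dTree {a : List C} {x : C} {n : ℤ} :
    Tree M a x n → (Tree M a x (n + 1) →₀ K)
  | .node (p := p) e F h =>
      .single (.node (M.d e) F (by omega)) 1
        + sgn K p • F.dTree.mapDomain (fun F' => .node e F' (by omega))

/-- All decorations of the forest lie in `S`. -/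
def Forest.All (S : ∀ c x n, Set (M.obj c x n)) : {c a : List C} → {n : ℤ} → Forest M c a n → Prop
  | _, _, _, .nil => True
  | _, _, _, .leaf _ F => F.All S
  | _, _, _, .graft e G F _ _ => e ∈ S _ _ _ ∧ G.All S ∧ F.All S

/-- All decorations of the tree lie in `S`. -/
def Tree.All (S : ∀ c x n, Set (M.obj c x n)) {a : List C} {x : C} {n : ℤ} : Tree M a x n → Prop
  | .node e F _ => e ∈ S _ _ _ ∧ F.All S

end Trees

section GroupoidTrees

variable {K : Type k} [Field K] {V : Type u} [Groupoid.{v} V]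

/-- The action of morphisms on the leaves of a forest. Morphisms on leaves that are bare trees of
the forest are returned as a morphism of the root profiles. -/
def Forest.act (E : GroupoidModule.{u, v, w} K V) : {c a a' : List V} → {n : ℤ} →
    Forest E.toColouredModule c a n → Homs a' a →
      (c' : List V) × Forest E.toColouredModule c' a' n × Homs c' c
  | _, _, _, _, .nil, .nil => ⟨_, .nil, .nil⟩
  | _, _, _, _, .leaf _ F, .cons (x := x') f fs =>
      let r := F.act E fs
      ⟨_, .leaf x' r.2.1, .cons f r.2.2⟩
  | _, _, _, _, .graft (x := x) e G F s h, .cons f fs =>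
      let r := s.pull fs
      let g := G.act E (.cons f r.2.2.2.1)
      let t := F.act E r.2.2.2.2
      ⟨_, .graft (E.act g.2.2 (𝟙 x) e) g.2.1 t.2.1 r.2.2.1 h, .cons (𝟙 x) t.2.2⟩

/-- The action of morphisms on the leaves and on the root of a tree. -/
def Tree.act (E : GroupoidModule.{u, v, w} K V) {a a' : List V} {x x' : V} {n : ℤ}
    (f : Homs a' a) (g : x ⟶ x') : Tree E.toColouredModule a x n → Tree E.toColouredModule a' x' n
  | .node e F h => .node (E.act (F.act E f).2.2 g e) (F.act E f).2.1 h

/-- `F.Move k F'`: the tuple `k` of morphisms is `g ∈ N` at one of the trees of `F` that is not a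
bare leaf and the identity elsewhere, and `F'` arises from `F` by the action of `g` on the output of
the root vertex of that tree. -/
inductive Forest.Move (E : GroupoidModule.{u, v, w} K V) (N : Subgroupoid V) :
    ∀ {c c' a : List V} {n : ℤ}, Forest E.toColouredModule c' a n → Homs c' c →
      Forest E.toColouredModule c a n → Prop
  | head {c c' a b a' : List V} {x x' y : V} {p q r n : ℤ} (g : x' ⟶ x) (hg : g ∈ N.arrows x' x)
      (e : E.obj c x' p) (G : Forest E.toColouredModule c (y :: b) q)
      (F : Forest E.toColouredModule c' a r) (s : Shuffle b a a') (h : p + q + r = n) :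
      Move E N (.graft e G F s h) (.cons g (Homs.id c'))
        (.graft (E.act (Homs.id c) g e) G F s h)
  | leaf {c c' a : List V} {n : ℤ} (x : V) {F : Forest E.toColouredModule c' a n} {f : Homs c' c}
      {F' : Forest E.toColouredModule c a n} (hF : Move E N F f F') :
      Move E N (.leaf x F) (.cons (𝟙 x) f) (.leaf x F')
  | tail {c d d' a b a' : List V} {x y : V} {p q r n : ℤ} (e : E.obj c x p)
      (G : Forest E.toColouredModule c (y :: b) q) {F : Forest E.toColouredModule d' a r}
      {f : Homs d' d} {F' : Forest E.toColouredModule d a r} (s : Shuffle b a a')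
      (h : p + q + r = n) (hF : Move E N F f F') :
      Move E N (.graft e G F s h) (.cons (𝟙 x) f) (.graft e G F' s h)

/-- One forest arises from the other by the action of a morphism of `N` on one internal edge: the
morphism is moved from the input of one end of the edge to the output of the other end. -/
inductive Forest.Step (E : GroupoidModule.{u, v, w} K V) (N : Subgroupoid V) :
    ∀ {c a : List V} {n : ℤ}, Forest E.toColouredModule c a n →
      Forest E.toColouredModule c a n → Prop
  | edge {c d d' a b a' : List V} {x y : V} {p q r n : ℤ} (e : E.obj d x p)
      {G : Forest E.toColouredModule d' (y :: b) q} {f : Homs d' d}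
      {G' : Forest E.toColouredModule d (y :: b) q} (F : Forest E.toColouredModule c a r)
      (s : Shuffle b a a') (h : p + q + r = n) (hG : Forest.Move E N G f G') :
      Step E N (.graft (E.act f (𝟙 x) e) G F s h) (.graft e G' F s h)
  | leaf {c a : List V} {n : ℤ} (x : V) {F F' : Forest E.toColouredModule c a n}
      (hF : Step E N F F') : Step E N (.leaf x F) (.leaf x F')
  | sub {c d a b a' : List V} {x y : V} {p q r n : ℤ} (e : E.obj d x p)
      {G G' : Forest E.toColouredModule d (y :: b) q} (F : Forest E.toColouredModule c a r)
      (s : Shuffle b a a') (h : p + q + r = n) (hG : Step E N G G') :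
      Step E N (.graft e G F s h) (.graft e G' F s h)
  | tail {c d a b a' : List V} {x y : V} {p q r n : ℤ} (e : E.obj d x p)
      (G : Forest E.toColouredModule d (y :: b) q) {F F' : Forest E.toColouredModule c a r}
      (s : Shuffle b a a') (h : p + q + r = n) (hF : Step E N F F') :
      Step E N (.graft e G F s h) (.graft e G F' s h)

/-- One tree arises from the other by the action of a morphism of `N` on one internal edge. -/
inductive Tree.Step (E : GroupoidModule.{u, v, w} K V) (N : Subgroupoid V) :
    ∀ {a : List V} {x : V} {n : ℤ}, Tree E.toColouredModule a x n →
      Tree E.toColouredModule a x n → Prop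
  | edge {d d' a : List V} {x : V} {p q n : ℤ} (e : E.obj d x p)
      {G : Forest E.toColouredModule d' a q} {f : Homs d' d}
      {G' : Forest E.toColouredModule d a q} (h : p + q = n) (hG : Forest.Move E N G f G') :
      Step E N (.node (E.act f (𝟙 x) e) G h) (.node e G' h)
  | sub {d a : List V} {x : V} {p q n : ℤ} (e : E.obj d x p)
      {G G' : Forest E.toColouredModule d a q} (h : p + q = n) (hG : Forest.Step E N G G') :
      Step E N (.node e G h) (.node e G' h)

end GroupoidTrees

/-! ### Operads, ideals and quotients -/

/-- The structure of a (non-unital) `C`-coloured shuffle operad in differential graded vector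
spaces: its components, its differential and its partial shuffle compositions. Only the free
operads constructed below and their quotients are used. -/
structure Operad (K : Type k) [Field K] (C : Type u) where
  obj : List C → C → ℤ → Type w
  [acg : ∀ c x n, AddCommGroup (obj c x n)]
  [mod : ∀ c x n, Module K (obj c x n)]
  d : ∀ {c x n}, obj c x n →ₗ[K] obj c x (n + 1)
  comp : ∀ {c b a : List C} {x z : C} {p q n : ℤ}, Graft c x b a → p + q = n →
    (obj c z p →ₗ[K] obj b x q →ₗ[K] obj a z n)

attribute [instance] Operad.acg Operad.mod

/-- The structure of a `V`-coloured shuffle operad for a groupoid `V`. The projection `toOperad` is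
the forgetful functor to `ob(V)`-coloured shuffle operads: it forgets the action of `V`. -/
structure GroupoidOperad (K : Type k) [Field K] (V : Type u) [Groupoid.{v} V] extends
    Operad.{u, w} K V where
  act : ∀ {c c' x x' n}, Homs c' c → (x ⟶ x') → (obj c x n →ₗ[K] obj c' x' n)

section Ideals

variable {K : Type k} [Field K] {C : Type u}

/-- An ideal of an operad: a family of subcomplexes that contains every composite with a factor in
it. -/
structure Ideal (P : Operad.{u, w} K C) where
  carrier : ∀ a x n, Submodule K (P.obj a x n)
  d_mem : ∀ {a x n} {α : P.obj a x n}, α ∈ carrier a x n → P.d α ∈ carrier a x (n + 1)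
  comp_mem_left : ∀ {c b a : List C} {x z : C} {p q n : ℤ} (φ : Graft c x b a) (h : p + q = n)
    {α : P.obj c z p} (β : P.obj b x q), α ∈ carrier c z p → P.comp φ h α β ∈ carrier a z n
  comp_mem_right : ∀ {c b a : List C} {x z : C} {p q n : ℤ} (φ : Graft c x b a) (h : p + q = n)
    (α : P.obj c z p) {β : P.obj b x q}, β ∈ carrier b x q → P.comp φ h α β ∈ carrier a z n

/-- The ideal `⟨R⟩` generated by `R`: the smallest ideal that contains `R`. -/
def Ideal.gen {P : Operad.{u, w} K C} (R : ∀ a x n, Set (P.obj a x n)) : Ideal P where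
  carrier a x n := ⨅ (I : Ideal P) (_ : ∀ a x n, R a x n ⊆ I.carrier a x n), I.carrier a x n
  d_mem h := by
    simp only [Submodule.mem_iInf] at h ⊢
    exact fun I hI => I.d_mem (h I hI)
  comp_mem_left φ h _ β hα := by
    simp only [Submodule.mem_iInf] at hα ⊢
    exact fun I hI => I.comp_mem_left φ h β (hα I hI)
  comp_mem_right φ h α _ hβ := by
    simp only [Submodule.mem_iInf] at hβ ⊢
    exact fun I hI => I.comp_mem_right φ h α (hβ I hI)

/-- The quotient of an operad by an ideal, with the inherited structure. -/
def Operad.quotient (P : Operad.{u, w} K C) (I : Ideal P) : Operad.{u, w} K C where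
  obj a x n := P.obj a x n ⧸ I.carrier a x n
  d := Submodule.mapQ _ _ P.d fun _ hα => I.d_mem hα
  comp {c b a x z p q n} φ h :=
    ((P.comp φ h).compr₂ (I.carrier a z n).mkQ).liftQ₂ (I.carrier c z p) (I.carrier b x q)
      (fun α hα => by
        ext β
        exact (Submodule.Quotient.mk_eq_zero _).2 (I.comp_mem_left φ h β hα))
      (fun β hβ => by
        ext α
        exact (Submodule.Quotient.mk_eq_zero _).2 (I.comp_mem_right φ h α hβ))

/-- An isomorphism of `C`-coloured shuffle operads. -/
structure Operad.Iso (P Q : Operad.{u, w} K C) where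
  equiv : ∀ a x n, P.obj a x n ≃ₗ[K] Q.obj a x n
  map_d : ∀ {a x n} (α : P.obj a x n), equiv a x (n + 1) (P.d α) = Q.d (equiv a x n α)
  map_comp : ∀ {c b a : List C} {x z : C} {p q n : ℤ} (φ : Graft c x b a) (h : p + q = n)
    (α : P.obj c z p) (β : P.obj b x q),
    equiv a z n (P.comp φ h α β) = Q.comp φ h (equiv c z p α) (equiv b x q β)

variable {V : Type u} [Groupoid.{v} V]

/-- An ideal of a `V`-coloured operad is moreover stable under the action of `V`. -/
structure GroupoidIdeal (P : GroupoidOperad.{u, v, w} K V) extends Ideal P.toOperad where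
  act_mem : ∀ {a a' x x' n} (f : Homs a' a) (g : x ⟶ x') {α : P.obj a x n},
    α ∈ carrier a x n → P.act f g α ∈ carrier a' x' n

/-- The smallest ideal of a `V`-coloured operad that contains `R`. -/
def GroupoidIdeal.gen {P : GroupoidOperad.{u, v, w} K V} (R : ∀ a x n, Set (P.obj a x n)) :
    GroupoidIdeal P where
  carrier a x n :=
    ⨅ (I : GroupoidIdeal P) (_ : ∀ a x n, R a x n ⊆ I.carrier a x n), I.carrier a x n
  d_mem h := by
    simp only [Submodule.mem_iInf] at h ⊢
    exact fun I hI => I.d_mem (h I hI)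
  comp_mem_left φ h _ β hα := by
    simp only [Submodule.mem_iInf] at hα ⊢
    exact fun I hI => I.comp_mem_left φ h β (hα I hI)
  comp_mem_right φ h α _ hβ := by
    simp only [Submodule.mem_iInf] at hβ ⊢
    exact fun I hI => I.comp_mem_right φ h α (hβ I hI)
  act_mem f g _ hα := by
    simp only [Submodule.mem_iInf] at hα ⊢
    exact fun I hI => I.act_mem f g (hα I hI)

/-- The quotient of a `V`-coloured operad by an ideal. -/
def GroupoidOperad.quotient (P : GroupoidOperad.{u, v, w} K V) (I : GroupoidIdeal P) :
    GroupoidOperad.{u, v, w} K V where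
  toOperad := P.toOperad.quotient I.toIdeal
  act f g := Submodule.mapQ _ _ (P.act f g) fun _ hα => I.act_mem f g hα

end Ideals

/-! ### Free operads -/

noncomputable section Free

variable {K : Type k} [Field K] {C : Type u} {V : Type u} [Groupoid.{v} V]

/-- The formal linear combinations of decorated trees, before the multilinearity of decorations is
imposed. The composition is the grafting of trees, with the Koszul sign that comes from moving the
vertices of the grafted tree to their place in the planar order. -/
def formal (M : ColouredModule.{u, w} K C) : Operad.{u, max u w k} K C where
  obj a x n := Tree M a x n →₀ K
  d := Finsupp.linearCombination K Tree.dTree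
  comp {_ _ _ _ _ _ q _} φ h :=
    Finsupp.linearCombination K fun T => Finsupp.linearCombination K fun T' =>
      .single (T.comp φ T' h) (sgn K (q * T.after φ))

/-- The formal linear combinations of trees decorated by a `V`-module, with the action of `V` on
leaves and roots. -/
def formalV (E : GroupoidModule.{u, v, w} K V) : GroupoidOperad.{u, v, max u w k} K V where
  toOperad := formal E.toColouredModule
  act f g := Finsupp.lmapDomain K K (Tree.act E f g)

/-- Linearity in the decoration of a one-vertex tree. The ideal generated by these relations
expresses multilinearity in the decorations of all vertices of all trees. -/
inductive Multilinear (M : ColouredModule.{u, w} K C) :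
    ∀ a x n, Set ((formal M).obj a x n)
  | add {a : List C} {x : C} {n : ℤ} (e e' : M.obj a x n) :
      Multilinear M a x n
        (.single (.corolla (e + e')) 1 - (.single (.corolla e) 1 + .single (.corolla e') 1))
  | smul {a : List C} {x : C} {n : ℤ} (l : K) (e : M.obj a x n) :
      Multilinear M a x n (.single (.corolla (l • e)) 1 - l • .single (.corolla e) 1)

/-- The free `C`-coloured shuffle operad on `M`: the sum over all shuffle trees `T` of the tensor
product of the `M(w)` over the vertices `w` of `T`. -/
def free (M : ColouredModule.{u, w} K C) : Operad.{u, max u w k} K C :=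
  (formal M).quotient (Ideal.gen (Multilinear M))

/-- The free `V`-coloured shuffle operad on `E`: the sum over all shuffle trees `T` of the
coinvariants of the tensor product of the `E(w)` over the vertices `w` of `T` with respect to the
action of `N` on the internal edges of `T`. -/
def freeV (N : Subgroupoid V) (E : GroupoidModule.{u, v, w} K V) :
    GroupoidOperad.{u, v, max u w k} K V :=
  (formalV E).quotient (GroupoidIdeal.gen fun a x n =>
    Multilinear E.toColouredModule a x n ∪
      {ρ | ∃ T T' : Tree E.toColouredModule a x n, T.Step E N T' ∧
        ρ = .single T 1 - .single T' 1})

/-- The element of the free operad given by a decorated tree. -/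
def free.mk {M : ColouredModule.{u, w} K C} {a : List C} {x : C} {n : ℤ} (T : Tree M a x n) :
    (free M).obj a x n :=
  Submodule.Quotient.mk (.single T 1)

/-- The element `[T]` of the free `V`-coloured operad given by a decorated tree. -/
def freeV.mk (N : Subgroupoid V) {E : GroupoidModule.{u, v, w} K V} {a : List V} {x : V} {n : ℤ}
    (T : Tree E.toColouredModule a x n) : (freeV N E).obj a x n :=
  Submodule.Quotient.mk (.single T 1)

/-! ### Minimal representatives -/

/-- The `ob(V)`-coloured tree monomials with decorations in `S`. -/
def Monomial (E : GroupoidModule.{u, v, w} K V) (S : ∀ c x n, Set (E.obj c x n))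
    (a : List V) (x : V) (n : ℤ) : Type (max u w) :=
  {T : Tree E.toColouredModule a x n // T.All S}

variable {E : GroupoidModule.{u, v, w} K V} {S : ∀ c x n, Set (E.obj c x n)}

/-- The tree monomials that represent the same `V`-coloured tree monomial as `T`: the class of `T`
under the action of `N` on internal edges. -/
def Monomial.orbit (N : Subgroupoid V) {a : List V} {x : V} {n : ℤ} (T : Monomial E S a x n) :
    Set (Monomial E S a x n) :=
  {T' | Relation.EqvGen (Tree.Step E N) T.1 T'.1}

open Classical in
/-- The minimal representative `[T]_*` of the class of `T`. -/
def Monomial.star (N : Subgroupoid V) {a : List V} {x : V} {n : ℤ}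
    [LinearOrder (Monomial E S a x n)] (T : Monomial E S a x n) : Monomial E S a x n :=
  if h : ∃ T', IsLeast (T.orbit N) T' then h.choose else T

/-- The set `E_*²` of the relations `α ∘_φ β - [α ∘_φ β]_*` for `α, β ∈ S`. -/
def edgeRelations (N : Subgroupoid V) (E : GroupoidModule.{u, v, w} K V)
    (S : ∀ c x n, Set (E.obj c x n)) [∀ a x n, LinearOrder (Monomial E S a x n)]
    (a : List V) (x : V) (n : ℤ) : Set ((free E.toColouredModule).obj a x n) :=
  {ρ | ∃ (c b : List V) (y : V) (p q : ℤ) (φ : Graft c y b a) (h : p + q = n)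
    (α : E.obj c x p) (β : E.obj b y q) (T : Monomial E S a x n),
    α ∈ S c x p ∧ β ∈ S b y q ∧ T.1 = (Tree.corolla α).comp φ (Tree.corolla β) h ∧
    ρ = (free E.toColouredModule).comp φ h (free.mk (Tree.corolla α)) (free.mk (Tree.corolla β))
      - free.mk (T.star N).1}

/-- `IsStar N S r ρ` says that `ρ` is `r_*`: the element `r` is written as a linear combination
`∑ kᵢ [Tᵢ]` of `V`-coloured tree monomials, and `ρ = ∑ kᵢ [Tᵢ]_*`. -/
def IsStar (N : Subgroupoid V) (S : ∀ c x n, Set (E.obj c x n))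
    [∀ a x n, LinearOrder (Monomial E S a x n)] {a : List V} {x : V} {n : ℤ}
    (r : (freeV N E).obj a x n) (ρ : (free E.toColouredModule).obj a x n) : Prop :=
  ∃ l : Monomial E S a x n →₀ K,
    r = l.sum (fun T t => t • freeV.mk N T.1) ∧ ρ = l.sum (fun T t => t • free.mk (T.star N).1)

end Free

end ShuffleOp

/-! Both operads are quotients of the free `ob(V)`-coloured operad, so it suffices that the two
projections have the same kernel (`Operad.Hom.nonempty_iso`). One inclusion is direct: `[T]_*` lies
in the class of `T`, so both become equal in the free `V`-coloured operad. Hence the relations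
`E_*²` vanish there (`edgeRelations_subset_ker`) and `r_*` is sent to `r` (`IsStar.toFreeV`).

For the converse, every edge move on every tree must follow from `E_*²`. A tree with two vertices
has one internal edge, and successive moves on it compose to a single move. Its class is therefore
finite and has a least element, the same for both ends of a move; two relations from `E_*²` then
identify these ends, first for decorations in `S` and then for all by bilinearity
(`identifiesEdges_of_edgeRelations`). Larger trees arise from two-vertex trees by grafting. Ideals
are closed under grafting, and the Koszul signs at the two ends of a move agree because a move
changes neither shape nor degrees, so the congruence spreads to all trees
(`Ideal.IdentifiesEdges.congr_step`).

It remains to handle the closure under `V` that is required of ideals in a `V`-coloured operad. The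
action on leaves and root commutes with grafting, with the differential and with edge moves. Thus
`V` carries defining relations to defining relations, and the ordinary ideal that they generate is
already stable (`GroupoidOperad.Equivariant.gen_le`). For `R`, stability of the linear span plays
the same role. -/

namespace ShuffleOp

/-! ### Morphisms of operads -/

section Morphisms

variable {K : Type k} [Field K] {C : Type u}

/-- A morphism of `C`-coloured shuffle operads. -/
structure Operad.Hom (P Q : Operad.{u, w} K C) where
  map : ∀ a x n, P.obj a x n →ₗ[K] Q.obj a x n
  map_d : ∀ {a x n} (α : P.obj a x n), map a x (n + 1) (P.d α) = Q.d (map a x n α)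
  map_comp : ∀ {c b a : List C} {x z : C} {p q n : ℤ} (φ : Graft c x b a) (h : p + q = n)
    (α : P.obj c z p) (β : P.obj b x q),
    map a z n (P.comp φ h α β) = Q.comp φ h (map c z p α) (map b x q β)

variable {P Q Q' : Operad.{u, w} K C}

/-- The composite of two morphisms of operads. -/
def Operad.Hom.trans (f : P.Hom Q) (g : Q.Hom Q') : P.Hom Q' where
  map a x n := (g.map a x n).comp (f.map a x n)
  map_d α := by simp [f.map_d, g.map_d]
  map_comp φ h α β := by simp [f.map_comp, g.map_comp]

/-- The kernel of a morphism of operads. -/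
def Operad.Hom.ker (f : P.Hom Q) : Ideal P where
  carrier a x n := LinearMap.ker (f.map a x n)
  d_mem h := by
    rw [LinearMap.mem_ker] at h ⊢
    rw [f.map_d, h, map_zero]
  comp_mem_left φ h α β hα := by
    rw [LinearMap.mem_ker] at hα ⊢
    rw [f.map_comp, hα, map_zero, LinearMap.zero_apply]
  comp_mem_right φ h α β hβ := by
    rw [LinearMap.mem_ker] at hβ ⊢
    rw [f.map_comp, hβ, map_zero]

theorem Operad.Hom.mem_ker (f : P.Hom Q) {a : List C} {x : C} {n : ℤ} {α : P.obj a x n} :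
    α ∈ f.ker.carrier a x n ↔ f.map a x n α = 0 :=
  LinearMap.mem_ker

/-- The projection to a quotient operad. -/
def Operad.proj (P : Operad.{u, w} K C) (I : Ideal P) : P.Hom (P.quotient I) where
  map a x n := (I.carrier a x n).mkQ
  map_d _ := rfl
  map_comp _ _ _ _ := rfl

theorem Operad.proj_eq_zero (I : Ideal P) {a : List C} {x : C} {n : ℤ} {α : P.obj a x n} :
    (P.proj I).map a x n α = 0 ↔ α ∈ I.carrier a x n :=
  Submodule.Quotient.mk_eq_zero _

theorem Operad.proj_surjective (I : Ideal P) (a : List C) (x : C) (n : ℤ) :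
    Function.Surjective ((P.proj I).map a x n) :=
  Submodule.mkQ_surjective _

/-- A morphism of operads that vanishes on an ideal descends to the quotient. -/
def Operad.Hom.desc (f : P.Hom Q) (I : Ideal P)
    (hI : ∀ a x n, I.carrier a x n ≤ f.ker.carrier a x n) : (P.quotient I).Hom Q where
  map a x n := (I.carrier a x n).liftQ (f.map a x n) (hI a x n)
  map_d α := by
    obtain ⟨α, rfl⟩ := Submodule.mkQ_surjective _ α
    exact f.map_d α
  map_comp φ h α β := by
    obtain ⟨α, rfl⟩ := Submodule.mkQ_surjective _ α
    obtain ⟨β, rfl⟩ := Submodule.mkQ_surjective _ β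
    exact f.map_comp φ h α β

/-- Two quotients of an operad with the same kernel are isomorphic. -/
theorem Operad.Hom.nonempty_iso (f : P.Hom Q) (g : P.Hom Q')
    (hf : ∀ a x n, Function.Surjective (f.map a x n))
    (hg : ∀ a x n, Function.Surjective (g.map a x n))
    (h : ∀ a x n, f.ker.carrier a x n = g.ker.carrier a x n) : Nonempty (Q.Iso Q') := by
  replace h : ∀ a x n, LinearMap.ker (f.map a x n) = LinearMap.ker (g.map a x n) := h
  let e : ∀ a x n, Q.obj a x n ≃ₗ[K] Q'.obj a x n := fun a x n =>
    ((f.map a x n).quotKerEquivOfSurjective (hf a x n)).symm ≪≫ₗ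
      (Submodule.quotEquivOfEq _ _ (h a x n)) ≪≫ₗ
        ((g.map a x n).quotKerEquivOfSurjective (hg a x n))
  have he : ∀ a x n (α : P.obj a x n), e a x n (f.map a x n α) = g.map a x n α := by
    intro a x n α
    have : ((f.map a x n).quotKerEquivOfSurjective (hf a x n)).symm (f.map a x n α) =
        Submodule.Quotient.mk α := by
      rw [LinearEquiv.symm_apply_eq]; rfl
    simp only [e, LinearEquiv.trans_apply, this]
    rfl
  refine ⟨⟨e, fun {a x n} α => ?_, fun {c b a x z p q n} φ h α β => ?_⟩⟩
  · obtain ⟨α, rfl⟩ := hf a x n α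
    rw [← f.map_d, he, he, g.map_d]
  · obtain ⟨α, rfl⟩ := hf c z p α
    obtain ⟨β, rfl⟩ := hf b x q β
    rw [← f.map_comp, he, he, he, g.map_comp]

theorem Ideal.subset_gen (R : ∀ a x n, Set (P.obj a x n)) {a : List C} {x : C} {n : ℤ}
    {α : P.obj a x n} (h : α ∈ R a x n) : α ∈ (Ideal.gen R).carrier a x n := by
  simp only [Ideal.gen, Submodule.mem_iInf]
  exact fun I hI => hI _ _ _ h

theorem Ideal.gen_le {R : ∀ a x n, Set (P.obj a x n)} (I : Ideal P)
    (h : ∀ a x n, R a x n ⊆ I.carrier a x n) (a : List C) (x : C) (n : ℤ) :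
    (Ideal.gen R).carrier a x n ≤ I.carrier a x n :=
  iInf₂_le I h

end Morphisms

/-! ### Equivariance -/

section Equivariance

variable {K : Type k} [Field K] {V : Type u} [Groupoid.{v} V]

/-- The action of `V` on a `V`-coloured operad commutes with the differential and with partial
compositions. -/
structure GroupoidOperad.Equivariant (P : GroupoidOperad.{u, v, w} K V) : Prop where
  act_d : ∀ {a a' : List V} {x x' : V} {n : ℤ} (f : Homs a' a) (g : x ⟶ x') (α : P.obj a x n),
    P.act f g (P.d α) = P.d (P.act f g α)
  act_comp : ∀ {c b a a' : List V} {x : V} (φ : Graft c x b a) (f : Homs a' a),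
    ∃ (c' b' : List V) (φ' : Graft c' x b' a') (f₁ : Homs c' c) (f₂ : Homs b' b),
      ∀ {z z' : V} {p q n : ℤ} (g : z ⟶ z') (h : p + q = n) (α : P.obj c z p) (β : P.obj b x q),
        P.act f g (P.comp φ h α β) = P.comp φ' h (P.act f₁ g α) (P.act f₂ (𝟙 x) β)

variable {P : GroupoidOperad.{u, v, w} K V}

theorem GroupoidOperad.Equivariant.quotient (hP : P.Equivariant) (I : GroupoidIdeal P) :
    (P.quotient I).Equivariant where
  act_d f g α := by
    obtain ⟨α, rfl⟩ := Submodule.mkQ_surjective _ α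
    exact congrArg (Submodule.mkQ _) (hP.act_d f g α)
  act_comp φ f := by
    obtain ⟨c', b', φ', f₁, f₂, H⟩ := hP.act_comp φ f
    refine ⟨c', b', φ', f₁, f₂, fun g h α β => ?_⟩
    obtain ⟨α, rfl⟩ := Submodule.mkQ_surjective _ α
    obtain ⟨β, rfl⟩ := Submodule.mkQ_surjective _ β
    exact congrArg (Submodule.mkQ _) (H g h α β)

/-- In an equivariant operad, the elements all of whose translates lie in a given ideal form an
ideal. -/
def GroupoidOperad.Equivariant.core (hP : P.Equivariant) (I : Ideal P.toOperad) :
    Ideal P.toOperad where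
  carrier a x n :=
    ⨅ (a' : List V) (x' : V) (f : Homs a' a) (g : x ⟶ x'), (I.carrier a' x' n).comap (P.act f g)
  d_mem h := by
    simp only [Submodule.mem_iInf, Submodule.mem_comap] at h ⊢
    intro a' x' f g
    rw [hP.act_d]
    exact I.d_mem (h a' x' f g)
  comp_mem_left φ h α β hα := by
    simp only [Submodule.mem_iInf, Submodule.mem_comap] at hα ⊢
    intro a' x' f g
    obtain ⟨c', b', φ', f₁, f₂, H⟩ := hP.act_comp φ f
    rw [H]
    exact I.comp_mem_left _ _ _ (hα _ _ _ _)
  comp_mem_right φ h α β hβ := by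
    simp only [Submodule.mem_iInf, Submodule.mem_comap] at hβ ⊢
    intro a' x' f g
    obtain ⟨c', b', φ', f₁, f₂, H⟩ := hP.act_comp φ f
    rw [H]
    exact I.comp_mem_right _ _ _ (hβ _ _ _ _)

theorem GroupoidIdeal.subset_gen (R : ∀ a x n, Set (P.obj a x n)) {a : List V} {x : V} {n : ℤ}
    {α : P.obj a x n} (h : α ∈ R a x n) : α ∈ (GroupoidIdeal.gen R).carrier a x n := by
  simp only [GroupoidIdeal.gen, Submodule.mem_iInf]
  exact fun I hI => hI _ _ _ h

theorem GroupoidIdeal.gen_le {R : ∀ a x n, Set (P.obj a x n)} (I : GroupoidIdeal P)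
    (h : ∀ a x n, R a x n ⊆ I.carrier a x n) (a : List V) (x : V) (n : ℤ) :
    (GroupoidIdeal.gen R).carrier a x n ≤ I.carrier a x n :=
  iInf₂_le I h

/-- If the translates of the generators lie in the ideal that they generate, then this ideal is
stable under the action of `V`. -/
theorem GroupoidOperad.Equivariant.gen_le (hP : P.Equivariant) {R : ∀ a x n, Set (P.obj a x n)}
    (hR : ∀ (a a' : List V) (x x' : V) (n : ℤ) (f : Homs a' a) (g : x ⟶ x'), ∀ r ∈ R a x n,
      P.act f g r ∈ (Ideal.gen (P := P.toOperad) R).carrier a' x' n)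
    (a : List V) (x : V) (n : ℤ) :
    (GroupoidIdeal.gen R).carrier a x n ≤ (Ideal.gen (P := P.toOperad) R).carrier a x n := by
  -- The generators lie in the core of the ideal that they generate, which is itself an ideal; by
  -- minimality the whole generated ideal lies in its core, and this is stability.
  have hcore := Ideal.gen_le (R := R) (hP.core (Ideal.gen (P := P.toOperad) R))
    (fun a x n r hr => by
      simp only [GroupoidOperad.Equivariant.core, SetLike.mem_coe, Submodule.mem_iInf,
        Submodule.mem_comap]
      exact fun a' x' f g => hR a a' x x' n f g r hr)
  refine GroupoidIdeal.gen_le ⟨Ideal.gen (P := P.toOperad) R, fun {a a' x x' n} f g α hα => ?_⟩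
    (fun a x n r hr => Ideal.subset_gen (P := P.toOperad) R hr) a x n
  have := hcore a x n hα
  simp only [GroupoidOperad.Equivariant.core, Submodule.mem_iInf, Submodule.mem_comap] at this
  exact this a' x' f g

end Equivariance

/-! ### Shuffles and grafting -/

section Shuffles

variable {C : Type u}

theorem Shuffle.symm_symm : ∀ {l m n : List C} (s : Shuffle l m n), s.symm.symm = s
  | _, _, _, .nil => rfl
  | _, _, _, .left x s => congrArg (Shuffle.left x) s.symm_symm
  | _, _, _, .right x s => congrArg (Shuffle.right x) s.symm_symm

/-- Rebracketing loses no information. Surjectivity is the half needed: it finds, for a grafting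
inside one tree of a forest, the grafting on the whole forest that induces it. The next three lemmas
serve the same purpose. -/
theorem Shuffle.exists_assocL : ∀ {l k l' m p : List C} (t : Shuffle l k l') (s : Shuffle l' m p),
    ∃ (n : List C) (s₀ : Shuffle l m n) (t₀ : Shuffle n k p), s₀.assocL t₀ = ⟨l', t, s⟩
  | _, _, _, _, _, .nil, .nil => ⟨_, .nil, .nil, rfl⟩
  | _, _, _, _, _, t, .right x s => by
      obtain ⟨n, s₀, t₀, h⟩ := exists_assocL t s
      exact ⟨_, .right x s₀, .left x t₀, by rw [assocL, h]⟩
  | _, _, _, _, _, .left x t, .left _ s => by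
      obtain ⟨n, s₀, t₀, h⟩ := exists_assocL t s
      exact ⟨_, .left x s₀, .left x t₀, by rw [assocL, h]⟩
  | _, _, _, _, _, .right x t, .left _ s => by
      obtain ⟨n, s₀, t₀, h⟩ := exists_assocL t s
      exact ⟨_, s₀, .right x t₀, by rw [assocL, h]⟩

theorem Shuffle.exists_assocR : ∀ {m k m' l p : List C} (t : Shuffle m k m') (s : Shuffle l m' p),
    ∃ (n : List C) (s₀ : Shuffle l m n) (t₀ : Shuffle n k p), s₀.assocR t₀ = ⟨m', t, s⟩
  | _, _, _, _, _, .nil, .nil => ⟨_, .nil, .nil, rfl⟩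
  | _, _, _, _, _, t, .left x s => by
      obtain ⟨n, s₀, t₀, h⟩ := exists_assocR t s
      exact ⟨_, .left x s₀, .left x t₀, by rw [assocR, h]⟩
  | _, _, _, _, _, .left x t, .right _ s => by
      obtain ⟨n, s₀, t₀, h⟩ := exists_assocR t s
      exact ⟨_, .right x s₀, .left x t₀, by rw [assocR, h]⟩
  | _, _, _, _, _, .right x t, .right _ s => by
      obtain ⟨n, s₀, t₀, h⟩ := exists_assocR t s
      exact ⟨_, s₀, .right x t₀, by rw [assocR, h]⟩

theorem Shuffle.exists_split_inl : ∀ {l m b l' n' : List C} {x : C} (φ : Graft l x b l')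
    (s : Shuffle l' m n'), ∃ (n : List C) (s₀ : Shuffle l m n) (φ₀ : Graft n x b n'),
      s₀.split φ₀ = .inl ⟨l', φ, s⟩
  | _, _, _, _, _, _, .here x y t, .left _ s => by
      obtain ⟨n, s₀, t₀, h⟩ := exists_assocL t s
      exact ⟨_, .left x s₀, .here x y t₀, by rw [split, h]⟩
  | _, _, _, _, _, _, .there y φ, .left _ s => by
      obtain ⟨n, s₀, φ₀, h⟩ := exists_split_inl φ s
      exact ⟨_, .left y s₀, .there y φ₀, by simp [split, h]⟩
  | _, _, _, _, _, _, φ, .right y s => by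
      obtain ⟨n, s₀, φ₀, h⟩ := exists_split_inl φ s
      exact ⟨_, .right y s₀, .there y φ₀, by simp [split, h]⟩

theorem Shuffle.exists_split_inr : ∀ {l m b m' n' : List C} {x : C} (φ : Graft m x b m')
    (s : Shuffle l m' n'), ∃ (n : List C) (s₀ : Shuffle l m n) (φ₀ : Graft n x b n'),
      s₀.split φ₀ = .inr ⟨m', φ, s⟩
  | _, _, _, _, _, _, .here x y t, .right _ s => by
      obtain ⟨n, s₀, t₀, h⟩ := exists_assocR t s
      exact ⟨_, .right x s₀, .here x y t₀, by rw [split, h]⟩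
  | _, _, _, _, _, _, .there y φ, .right _ s => by
      obtain ⟨n, s₀, φ₀, h⟩ := exists_split_inr φ s
      exact ⟨_, .right y s₀, .there y φ₀, by simp [split, h]⟩
  | _, _, _, _, _, _, φ, .left y s => by
      obtain ⟨n, s₀, φ₀, h⟩ := exists_split_inr φ s
      exact ⟨_, .left y s₀, .there y φ₀, by simp [split, h]⟩

/-- Extension of a partial composition by further inputs in front, the last of them listed first. -/
def Graft.pre : (d : List C) → {c b a : List C} → {x : C} → Graft c x b a →
    Graft (d.reverseAux c) x b (d.reverseAux a)
  | [], _, _, _, _, φ => φ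
  | y :: d, _, _, _, _, φ => pre d (.there y φ)

end Shuffles

/-! ### Forests with bare leaves in front, and forests as iterated graftings. -/

section Prefix

variable {K : Type k} [Field K] {C : Type u} {M : ColouredModule.{u, w} K C}

/-- Extension of a forest by bare leaves in front, the last of them listed first. -/
def Forest.pre : (d : List C) → {c a : List C} → {n : ℤ} → Forest M c a n →
    Forest M (d.reverseAux c) (d.reverseAux a) n
  | [], _, _, _, F => F
  | y :: d, _, _, _, F => pre d (.leaf y F)

/-- Since `(y :: d).reverseAux c` reduces to `d.reverseAux (y :: c)`, an induction that passes a
bare leaf can push its colour onto `d` without any transport along equalities of lists. -/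
theorem Forest.pre_leaves (c : List C) : ∀ d : List C,
    (Forest.leaves (M := M) c).pre d = Forest.leaves (d.reverseAux c) := by
  intro d
  induction d generalizing c with
  | nil => rfl
  | cons y d ih => exact ih (y :: c)

theorem Forest.pre_comp (d : List C) {c a b a' : List C} {x : C} {p q n : ℤ} (F : Forest M c a p)
    (φ : Graft a x b a') (T : Tree M b x q) (h : p + q = n) :
    (F.pre d).comp (φ.pre d) T h = (F.comp φ T h).pre d := by
  induction d generalizing c a a' with
  | nil => rfl
  | cons y d ih =>
    refine (ih (.leaf y F) (.there y φ)).trans ?_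
    simp [Forest.comp, Forest.pre]

theorem Forest.pre_after (d : List C) {c a b a' : List C} {x : C} {p : ℤ} (F : Forest M c a p)
    (φ : Graft a x b a') : (F.pre d).after (φ.pre d) = F.after φ := by
  induction d generalizing c a a' with
  | nil => rfl
  | cons y d ih =>
    refine (ih (.leaf y F) (.there y φ)).trans ?_
    simp [Forest.after]

/-- Reads the constructor `graft` as an operadic composition, so that closure of ideals under
composition applies to it. -/
theorem Forest.leaf_comp_here {c c' a b a' : List C} {x y : C} {p q q' r n : ℤ} (e : M.obj c x p)
    (G : Forest M c (y :: b) q) (F : Forest M c' a r) (s : Shuffle b a a') (h : p + q + r = n)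
    (h' : p + q = q') (h'' : r + q' = n) :
    (Forest.leaf x F).comp (.here x y s.symm) (.node e G h') h'' = .graft e G F s h := by
  simp [Forest.comp, Shuffle.symm_symm]

/-- Every forest arises from bare leaves by grafting. -/
theorem Forest.induction_comp {motive : ∀ {c a : List C} {n : ℤ}, Forest M c a n → Prop}
    (leaves : ∀ c, motive (Forest.leaves c))
    (comp : ∀ {c a b a' : List C} {x : C} {p q n : ℤ} (F : Forest M c a p) (φ : Graft a x b a')
      (T : Tree M b x q) (h : p + q = n), motive F → motive (F.comp φ T h))
    {c a : List C} {n : ℤ} (F : Forest M c a n) : motive F := by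
  -- The `graft` case needs the motive for `leaf x F`, not for `F`. With a free prefix this is the
  -- hypothesis for `F` at the prefix `x :: d`.
  suffices ∀ d, motive (F.pre d) from this []
  induction F with
  | nil =>
    intro d
    exact (Forest.pre_leaves (M := M) [] d).symm ▸ leaves _
  | leaf x F ih => exact fun d => ih (x :: d)
  | graft e G F s h _ ih =>
    intro d
    rw [← Forest.leaf_comp_here e G F s h rfl (by omega), ← Forest.pre_comp]
    exact comp _ _ _ _ (ih (_ :: d))

/-- A grafting onto a tree beside the first one is a grafting onto the whole forest. The witnesses
depend on the shuffles only, so the same ones serve both ends of an edge move, whose decorations and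
root colours differ. -/
theorem Forest.exists_graft_comp_right {a a₀ b b' a' : List C} {x' : C}
    (φ : Graft a₀ x' b' a) (s : Shuffle b a a') (y : C) :
    ∃ (a₁ : List C) (s₀ : Shuffle b a₀ a₁) (φ₀ : Graft a₁ x' b' a'),
      ∀ {c c' : List C} {x : C} {p q r r' t n m : ℤ} (e : M.obj c x p)
        (G : Forest M c (y :: b) q) (F : Forest M c' a₀ r) (T : Tree M b' x' t)
        (h : p + q + r = m) (h' : r + t = r') (h'' : m + t = n) (h''' : p + q + r' = n),
        (Forest.graft e G F s₀ h).comp (.there y φ₀) T h'' =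
          .graft e G (F.comp φ T h') s h''' := by
  obtain ⟨a₁, s₀, φ₀, hs⟩ := Shuffle.exists_split_inr φ s
  refine ⟨a₁, s₀, φ₀, fun e G F T h h' h'' h''' => ?_⟩
  subst h'
  simp [Forest.comp, hs]

/-- The analogue for a grafting above the root vertex of the first tree. Here the smallest leaf may
itself be grafted upon, which changes its colour from `y₀` to `y`. -/
theorem Forest.exists_graft_comp_left {a b b₀ b' a' : List C} {x' y y₀ : C}
    (φ : Graft (y₀ :: b₀) x' b' (y :: b)) (s : Shuffle b a a') :
    ∃ (a₁ : List C) (s₀ : Shuffle b₀ a a₁) (φ₀ : Graft (y₀ :: a₁) x' b' (y :: a')),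
      ∀ {c c' : List C} {x : C} {p q q' r t n m : ℤ} (e : M.obj c x p)
        (G : Forest M c (y₀ :: b₀) q) (F : Forest M c' a r) (T : Tree M b' x' t)
        (h : p + q + r = m) (h' : q + t = q') (h'' : m + t = n) (h''' : p + q' + r = n),
        (Forest.graft e G F s₀ h).comp φ₀ T h'' =
          .graft e (G.comp φ T h') F s h''' := by
  cases φ with
  | here x y t =>
    obtain ⟨a₁, s₀, t₀, hs⟩ := Shuffle.exists_assocL t s
    refine ⟨a₁, s₀, .here _ _ t₀, fun e G F T h h' h'' h''' => ?_⟩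
    subst h'
    rw [Forest.comp, hs]
  | there y φ =>
    obtain ⟨a₁, s₀, φ₀, hs⟩ := Shuffle.exists_split_inl φ s
    refine ⟨a₁, s₀, .there _ φ₀, fun e G F T h h' h'' h''' => ?_⟩
    subst h'
    simp [Forest.comp, hs]

/-- The root vertex precedes all its leaves in the planar order, so its decoration never enters the
Koszul sign of a grafting. -/
theorem Forest.graft_after_congr {c c' a b a' b' a'' : List C} {x x₁ x' y : C} {p q r n : ℤ}
    (e : M.obj c x p) (e₁ : M.obj c x₁ p)
    (G : Forest M c (y :: b) q) (F : Forest M c' a r) (s : Shuffle b a a') (h : p + q + r = n)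
    (φ : Graft (y :: a') x' b' a'') :
    (Forest.graft e G F s h).after φ = (Forest.graft e₁ G F s h).after φ := by
  cases φ <;> simp [Forest.after]

end Prefix

/-! ### Congruence of trees modulo an ideal -/

section Congruence

variable {K : Type k} [Field K] {C : Type u} {M : ColouredModule.{u, w} K C}

theorem sgn_mul_self (n : ℤ) : sgn K n * sgn K n = 1 := by
  rw [sgn, ← Int.cast_mul, ← Units.val_mul, Int.units_mul_self, Units.val_one, Int.cast_one]

theorem formal_comp_single {c b a : List C} {x z : C} {p q n : ℤ} (φ : Graft c x b a)
    (h : p + q = n) (T : Tree M c z p) (U : Tree M b x q) (s t : K) :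
    (formal M).comp φ h (Finsupp.single T s) (Finsupp.single U t) =
      Finsupp.single (T.comp φ U h) (s * (t * sgn K (q * T.after φ))) := by
  change (Finsupp.linearCombination K fun T => Finsupp.linearCombination K fun T' =>
    Finsupp.single (T.comp φ T' h) (sgn K (q * T.after φ))) (Finsupp.single T s)
      (Finsupp.single U t) = _
  rw [Finsupp.linearCombination_single]
  rw [LinearMap.smul_apply, Finsupp.linearCombination_single, Finsupp.smul_single,
    Finsupp.smul_single, smul_eq_mul, smul_eq_mul]

/-- Two decorated trees are congruent modulo an ideal. -/
def Ideal.Congr (I : Ideal (formal M)) {a : List C} {x : C} {n : ℤ} (T T' : Tree M a x n) : Prop :=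
  (Finsupp.single T 1 - Finsupp.single T' 1 : Tree M a x n →₀ K) ∈ I.carrier a x n

variable {I : Ideal (formal M)}

/-- The sign of a composition depends on the lower tree through `after`. When it is the same for
both trees, it is a common factor of square one and cancels. -/
theorem Ideal.Congr.comp_left {c b a : List C} {x z : C} {p q n : ℤ} {T T' : Tree M c z p}
    (hT : I.Congr T T') (φ : Graft c x b a) (h : p + q = n) (hφ : T.after φ = T'.after φ)
    (U : Tree M b x q) : I.Congr (T.comp φ U h) (T'.comp φ U h) := by
  have := (I.carrier a z n).smul_mem (sgn K (q * T.after φ))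
    (I.comp_mem_left φ h (Finsupp.single U 1) hT)
  have key : sgn K (q * T.after φ) • (formal M).comp φ h
      (Finsupp.single T 1 - Finsupp.single T' 1 : Tree M c z p →₀ K) (Finsupp.single U 1) =
      (Finsupp.single (T.comp φ U h) 1 - Finsupp.single (T'.comp φ U h) 1 :
        Tree M a z n →₀ K) := by
    erw [map_sub, LinearMap.sub_apply, formal_comp_single, formal_comp_single, ← hφ, smul_sub,
      Finsupp.smul_single, Finsupp.smul_single]
    simp [sgn_mul_self]
    rfl
  rw [key] at this
  exact this

/-- No condition on signs is needed: the sign sees the upper tree only through its degree. -/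
theorem Ideal.Congr.comp_right {c b a : List C} {x z : C} {p q n : ℤ} {U U' : Tree M b x q}
    (hU : I.Congr U U') (φ : Graft c x b a) (h : p + q = n) (T : Tree M c z p) :
    I.Congr (T.comp φ U h) (T.comp φ U' h) := by
  have := (I.carrier a z n).smul_mem (sgn K (q * T.after φ))
    (I.comp_mem_right φ h (Finsupp.single T 1) hU)
  have key : sgn K (q * T.after φ) • (formal M).comp φ h
      (Finsupp.single T 1) (Finsupp.single U 1 - Finsupp.single U' 1 : Tree M b x q →₀ K) =
      (Finsupp.single (T.comp φ U h) 1 - Finsupp.single (T.comp φ U' h) 1 :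
        Tree M a z n →₀ K) := by
    erw [map_sub, formal_comp_single, formal_comp_single, smul_sub,
      Finsupp.smul_single, Finsupp.smul_single]
    simp [sgn_mul_self]
    rfl
  rw [key] at this
  exact this

theorem Tree.node_after_pre {d c' a b a' : List C} {x y z : C} {p' r n : ℤ}
    (e₀ : M.obj (d.reverseAux (x :: c')) z p') (F : Forest M c' a r) (s : Shuffle a b a')
    (h : p' + r = n) :
    (Tree.node e₀ ((Forest.leaf x F).pre d) h).after ((Graft.here x y s).pre d) = r := by
  simp only [Tree.after]
  rw [Forest.pre_after, Forest.after]

/-- Congruences at the inputs of the root vertex of a subtree extend to the whole tree. -/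
theorem Ideal.Congr.graft {d c c₁ c' a b a' : List C} {x y z : C} {p p₁ p' q q₁ r m n : ℤ}
    {e : M.obj c x p} {e₁ : M.obj c₁ x p₁} {G : Forest M c (y :: b) q}
    {G₁ : Forest M c₁ (y :: b) q₁} {m' : ℤ} {hG : p + q = m'} {hG₁ : p₁ + q₁ = m'}
    (H : I.Congr (.node e G hG) (.node e₁ G₁ hG₁))
    (e₀ : M.obj (d.reverseAux (x :: c')) z p') (F : Forest M c' a r) (s : Shuffle b a a')
    (h : p + q + r = m) (h₁ : p₁ + q₁ + r = m) (h₀ : p' + m = n) :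
    I.Congr (.node e₀ ((Forest.graft e G F s h).pre d) h₀)
      (.node e₀ ((Forest.graft e₁ G₁ F s h₁).pre d) h₀) := by
  -- The subtree is cut off at its root edge: the whole tree is the remaining tree, with a bare leaf
  -- `x` in its place, composed with the subtree.
  have := H.comp_right ((Graft.here x y s.symm).pre d) (show p' + r + m' = n by omega)
    (.node e₀ ((Forest.leaf x F).pre d) rfl)
  obtain rfl : m = r + m' := by omega
  simp only [Tree.comp] at this
  rw [Forest.pre_comp, Forest.pre_comp, Forest.leaf_comp_here e G F s h hG,
    Forest.leaf_comp_here e₁ G₁ F s h₁ hG₁] at this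
  exact this

/-- Congruences at the later trees of a list of trees extend to the whole list. -/
theorem Ideal.Congr.tail {d c c' c₁ a b a' : List C} {x y z : C} {p p' q r m n n' : ℤ}
    {e₀ : M.obj (d.reverseAux (x :: c')) z p'} {e₁ : M.obj (d.reverseAux (x :: c₁)) z p'}
    {F : Forest M c' a r} {F₁ : Forest M c₁ a r} {hF : p' + r = n'}
    (H : I.Congr (.node e₀ ((Forest.leaf x F).pre d) hF) (.node e₁ ((Forest.leaf x F₁).pre d) hF))
    (e : M.obj c x p) (G : Forest M c (y :: b) q) (s : Shuffle b a a')
    (h : p + q + r = m) (h₀ : p' + m = n) :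
    I.Congr (.node e₀ ((Forest.graft e G F s h).pre d) h₀)
      (.node e₁ ((Forest.graft e G F₁ s h).pre d) h₀) := by
  -- The first tree is grafted back onto the bare leaf `x`. Only vertices of `F` or `F₁` come after
  -- this leaf, in both cases of total degree `r`, so the signs agree.
  have := H.comp_left ((Graft.here x y s.symm).pre d) (show n' + (p + q) = n by omega)
    (by rw [Tree.node_after_pre, Tree.node_after_pre]) (.node e G rfl)
  obtain rfl : m = r + (p + q) := by omega
  simp only [Tree.comp] at this
  rw [Forest.pre_comp, Forest.pre_comp, Forest.leaf_comp_here e G F s h rfl,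
    Forest.leaf_comp_here e G F₁ s h rfl] at this
  exact this

end Congruence

/-! ### From two-vertex trees to all trees -/

section Steps

variable {K : Type k} [Field K] {V : Type u} [Groupoid.{v} V] {E : GroupoidModule.{u, v, w} K V}

/-- Extension of a morphism of profiles by identities in front. -/
def Homs.pre : (d : List V) → {c' c : List V} → Homs c' c →
    Homs (d.reverseAux c') (d.reverseAux c)
  | [], _, _, f => f
  | y :: d, _, _, f => pre d (.cons (𝟙 y) f)

/-- The ideal identifies the two-vertex trees that arise from each other by the action of a
morphism of `N` on the internal edge. -/
def Ideal.IdentifiesEdges (N : Subgroupoid V) (I : Ideal (formal E.toColouredModule)) : Prop :=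
  ∀ {c b a : List V} {x x' y z : V} {p q m n : ℤ} (d : List V) (g : x' ⟶ x)
    (_ : g ∈ N.arrows x' x) (e₀ : E.obj (d.reverseAux (x :: c)) z p) (e : E.obj (y :: b) x' q)
    (s : Shuffle b c a) (h : q + 0 + 0 = m) (h₀ : p + m = n),
    I.Congr
      (.node (E.act (Homs.pre d (.cons g (Homs.id c))) (𝟙 z) e₀)
        ((Forest.graft e (Forest.leaves (y :: b)) (Forest.leaves c) s h).pre d) h₀)
      (.node e₀ ((Forest.graft (E.act (Homs.id (y :: b)) g e) (Forest.leaves (y :: b))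
        (Forest.leaves c) s h).pre d) h₀)

variable {N : Subgroupoid V} {I : Ideal (formal E.toColouredModule)}

/-- The trees `F` beside the upper vertex grow from bare leaves by grafting, and each such grafting
is one onto the whole tree, hence preserves the congruence. -/
theorem Ideal.IdentifiesEdges.congr_leaves_left (hI : I.IdentifiesEdges N) {b : List V}
    {x x' y z : V} (d : List V) (g : x' ⟶ x) (hg : g ∈ N.arrows x' x)
    {p q : ℤ} (e : E.obj (y :: b) x' q)
    {c a : List V} {r : ℤ} (F : Forest E.toColouredModule c a r) :
    ∀ {a' : List V} {m n : ℤ} (e₀ : E.obj (d.reverseAux (x :: c)) z p)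
    (s : Shuffle b a a') (h : q + 0 + r = m) (h₀ : p + m = n),
    I.Congr
      (.node (E.act (Homs.pre d (.cons g (Homs.id c))) (𝟙 z) e₀)
        ((Forest.graft e (Forest.leaves (y :: b)) F s h).pre d) h₀)
      (.node e₀ ((Forest.graft (E.act (Homs.id (y :: b)) g e) (Forest.leaves (y :: b))
        F s h).pre d) h₀) := by
  induction F using Forest.induction_comp with
  | leaves c => exact fun e₀ s h h₀ => hI d g hg e₀ e s h h₀
  | @comp c a₀ b' a x₁ r t r' F φ T hr ih =>
    intro a' m n e₀ s h h₀
    obtain ⟨a₁, s₀, φ₀, H⟩ := Forest.exists_graft_comp_right (M := E.toColouredModule) φ s y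
    obtain rfl : m = (q + 0 + r) + t := by omega
    have := (ih e₀ s₀ rfl rfl).comp_left ((Graft.there y φ₀).pre d)
      (show p + (q + 0 + r) + t = n by omega)
      (by
        simp only [Tree.after]
        rw [Forest.pre_after, Forest.pre_after]
        exact Forest.graft_after_congr _ _ _ _ _ _ _) T
    simp only [Tree.comp] at this
    rw [Forest.pre_comp, Forest.pre_comp, H _ _ F T rfl hr rfl h, H _ _ F T rfl hr rfl h] at this
    exact this

/-- Now the trees `G` above the upper vertex are built up by grafting. Their leaf profile has the
form `y :: b`, which is no free index for the induction; hence the variable `b₁`, the equation and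
the heterogeneous equality. -/
theorem Ideal.IdentifiesEdges.congr_head (hI : I.IdentifiesEdges N)
    {x x' z : V} (d : List V) (g : x' ⟶ x) (hg : g ∈ N.arrows x' x) {p q t : ℤ}
    {c' b₁ : List V} (G : Forest E.toColouredModule c' b₁ t) :
    ∀ {c b a a' : List V} {r : ℤ} {y : V} (_ : b₁ = y :: b)
    (G' : Forest E.toColouredModule c' (y :: b) t) (_ : HEq G G')
    (F : Forest E.toColouredModule c a r) {m n : ℤ} (e : E.obj c' x' q)
    (e₀ : E.obj (d.reverseAux (x :: c)) z p) (s : Shuffle b a a') (h : q + t + r = m)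
    (h₀ : p + m = n),
    I.Congr
      (.node (E.act (Homs.pre d (.cons g (Homs.id c))) (𝟙 z) e₀)
        ((Forest.graft e G' F s h).pre d) h₀)
      (.node e₀ ((Forest.graft (E.act (Homs.id c') g e) G' F s h).pre d) h₀) := by
  induction G using Forest.induction_comp with
  | leaves c =>
    rintro c b a a' r y rfl _ ⟨⟩ F m n e e₀ s h h₀
    exact hI.congr_leaves_left d g hg e F e₀ s h h₀
  | @comp c' b₀ b' b₁ x₁ t₀ t' t G φ T ht ih =>
    rintro c b a a' r y rfl _ ⟨⟩ F m n e e₀ s h h₀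
    obtain ⟨y₀, b₀', rfl⟩ : ∃ y₀ b₀', b₀ = y₀ :: b₀' := by cases φ <;> exact ⟨_, _, rfl⟩
    obtain ⟨a₁, s₀, φ₀, H⟩ := Forest.exists_graft_comp_left (M := E.toColouredModule) φ s
    obtain rfl : m = (q + t₀ + r) + t' := by omega
    have := (ih rfl G HEq.rfl F e e₀ s₀ rfl rfl).comp_left (φ₀.pre d)
      (show p + (q + t₀ + r) + t' = n by omega)
      (by
        simp only [Tree.after]
        rw [Forest.pre_after, Forest.pre_after]
        exact Forest.graft_after_congr _ _ _ _ _ _ _) T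
    simp only [Tree.comp] at this
    rw [Forest.pre_comp, Forest.pre_comp, H _ G F T rfl ht rfl h, H _ G F T rfl ht rfl h] at this
    exact this

/-- The moved tree may stand anywhere among the inputs. Bare leaves before it join the prefix `d`; a
tree before it is first replaced by a bare leaf and then grafted back. -/
theorem Ideal.IdentifiesEdges.congr_move (hI : I.IdentifiesEdges N) {c c' a : List V} {q : ℤ}
    {G : Forest E.toColouredModule c' a q} {f : Homs c' c} {G' : Forest E.toColouredModule c a q}
    (hG : Forest.Move E N G f G') :
    ∀ (d : List V) {z : V} {p n : ℤ} (e : E.obj (d.reverseAux c) z p) (h : p + q = n),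
      I.Congr (.node (E.act (Homs.pre d f) (𝟙 z) e) (G.pre d) h) (.node e (G'.pre d) h) := by
  induction hG with
  | head g hg e G F s h =>
    exact fun d z p n e₀ h₀ => hI.congr_head d g hg G rfl G HEq.rfl F e e₀ s h h₀
  | leaf x _ ih => exact fun d => ih (x :: d)
  | tail e G s h _ ih =>
    exact fun d z p n e₀ h₀ => Ideal.Congr.tail (ih (_ :: d) e₀ rfl) e G s h h₀

/-- A move away from the root takes place in a proper subtree, where it is a move at the root or
again a deeper one; the congruence found there is inserted into the rest of the tree. -/
theorem Ideal.IdentifiesEdges.congr_forestStep (hI : I.IdentifiesEdges N) {c a : List V} {q : ℤ}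
    {F F' : Forest E.toColouredModule c a q} (hF : Forest.Step E N F F') :
    ∀ (d : List V) {z : V} {p n : ℤ} (e : E.obj (d.reverseAux c) z p) (h : p + q = n),
      I.Congr (.node e (F.pre d) h) (.node e (F'.pre d) h) := by
  induction hF with
  | edge e F s h hG =>
    exact fun d z p n e₀ h₀ => (hI.congr_move hG [] e rfl).graft e₀ F s h h h₀
  | leaf x _ ih => exact fun d => ih (x :: d)
  | sub e F s h _ ih => exact fun d z p n e₀ h₀ => (ih [] e rfl).graft e₀ F s h h h₀
  | tail e G s h _ ih =>
    exact fun d z p n e₀ h₀ => Ideal.Congr.tail (ih (_ :: d) e₀ rfl) e G s h h₀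

/-- An ideal that identifies the ends of the edge moves on two-vertex trees identifies the ends of
all edge moves. -/
theorem Ideal.IdentifiesEdges.congr_step (hI : I.IdentifiesEdges N) {a : List V} {x : V} {n : ℤ}
    {T T' : Tree E.toColouredModule a x n} (hT : T.Step E N T') : I.Congr T T' := by
  cases hT with
  | edge e h hG => exact hI.congr_move hG [] e h
  | sub e h hG => exact hI.congr_forestStep hG [] e h

end Steps

/-! ### The action of the groupoid on trees -/

section Pull

variable {V : Type u} [Groupoid.{v} V]

theorem Homs.id_comp : ∀ {l m : List V} (f : Homs l m), (Homs.id l).comp f = f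
  | _, _, .nil => rfl
  | _, _, .cons f fs => by rw [Homs.id, Homs.comp, Category.id_comp, Homs.id_comp fs]

theorem Homs.comp_id : ∀ {l m : List V} (f : Homs l m), f.comp (Homs.id m) = f
  | _, _, .nil => rfl
  | _, _, .cons f fs => by rw [Homs.id, Homs.comp, Category.comp_id, Homs.comp_id fs]

/-- The graph of `Shuffle.pull`. -/
inductive Shuffle.IsPull : ∀ {l m n l' m' n' : List V}, Shuffle l m n → Homs n' n →
    Shuffle l' m' n' → Homs l' l → Homs m' m → Prop
  | nil : IsPull .nil .nil .nil .nil .nil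
  | left {l m n l' m' n' : List V} {x x' : V} (f : x' ⟶ x) {s : Shuffle l m n} {fs : Homs n' n}
      {s' : Shuffle l' m' n'} {f₁ : Homs l' l} {f₂ : Homs m' m} (h : IsPull s fs s' f₁ f₂) :
      IsPull (.left x s) (.cons f fs) (.left x' s') (.cons f f₁) f₂
  | right {l m n l' m' n' : List V} {x x' : V} (f : x' ⟶ x) {s : Shuffle l m n} {fs : Homs n' n}
      {s' : Shuffle l' m' n'} {f₁ : Homs l' l} {f₂ : Homs m' m} (h : IsPull s fs s' f₁ f₂) :
      IsPull (.right x s) (.cons f fs) (.right x' s') f₁ (.cons f f₂)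

theorem Shuffle.isPull_pull : ∀ {l m n n' : List V} (s : Shuffle l m n) (f : Homs n' n),
    IsPull s f (s.pull f).2.2.1 (s.pull f).2.2.2.1 (s.pull f).2.2.2.2
  | _, _, _, _, .nil, .nil => .nil
  | _, _, _, _, .left _ s, .cons f fs => .left f (s.isPull_pull fs)
  | _, _, _, _, .right _ s, .cons f fs => .right f (s.isPull_pull fs)

theorem Shuffle.IsPull.pull_eq {l m n l' m' n' : List V} {s : Shuffle l m n} {f : Homs n' n}
    {s' : Shuffle l' m' n'} {f₁ : Homs l' l} {f₂ : Homs m' m} (h : IsPull s f s' f₁ f₂) :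
    s.pull f = ⟨l', m', s', f₁, f₂⟩ := by
  induction h with
  | nil => rfl
  | left f _ ih => simp only [Shuffle.pull]; rw [ih]
  | right f _ ih => simp only [Shuffle.pull]; rw [ih]

theorem Shuffle.IsPull.symm {l m n l' m' n' : List V} {s : Shuffle l m n} {f : Homs n' n}
    {s' : Shuffle l' m' n'} {f₁ : Homs l' l} {f₂ : Homs m' m} (h : IsPull s f s' f₁ f₂) :
    IsPull s.symm f s'.symm f₂ f₁ := by
  induction h with
  | nil => exact .nil
  | left f _ ih => exact .right f ih
  | right f _ ih => exact .left f ih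

theorem Shuffle.assocL_right {C : Type u} {l m n k p : List C} (s : Shuffle l m n) (x : C)
    (t : Shuffle n k p) : s.assocL (.right x t) =
      ⟨_, .right x (s.assocL t).2.1, .left x (s.assocL t).2.2⟩ := by
  rw [Shuffle.assocL]

/-- Naturality of rebracketing. The intermediate list changes too, and `j` is the morphism induced
on it. -/
theorem Shuffle.IsPull.assocL {n k p n' k' p' : List V} {t : Shuffle n k p} {f : Homs p' p}
    {t' : Shuffle n' k' p'} {f₁ : Homs n' n} {f₂ : Homs k' k} (ht : IsPull t f t' f₁ f₂) :
    ∀ {l m l' m' : List V} {s : Shuffle l m n} {s' : Shuffle l' m' n'} {g₁ : Homs l' l}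
      {g₂ : Homs m' m} (_ : IsPull s f₁ s' g₁ g₂), ∃ j : Homs (s'.assocL t').1 (s.assocL t).1,
      IsPull (s.assocL t).2.2 f (s'.assocL t').2.2 j g₂ ∧
        IsPull (s.assocL t).2.1 j (s'.assocL t').2.1 g₁ f₂ := by
  induction ht with
  | nil =>
    rintro _ _ _ _ _ _ _ _ ⟨⟩
    exact ⟨.nil, .nil, .nil⟩
  | left f _ ih =>
    intro l m l' m' s s' g₁ g₂ hs
    cases hs with
    | left _ hs =>
      obtain ⟨j, h₁, h₂⟩ := ih hs
      exact ⟨.cons f j, .left f h₁,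
        .left f h₂⟩
    | right _ hs =>
      obtain ⟨j, h₁, h₂⟩ := ih hs
      exact ⟨j, .right f h₁,
        h₂⟩
  | right f _ ih =>
    intro l m l' m' s s' g₁ g₂ hs
    obtain ⟨j, h₁, h₂⟩ := ih hs
    rw [Shuffle.assocL_right, Shuffle.assocL_right]
    exact ⟨.cons f j, .left f h₁, .right f h₂⟩

theorem Shuffle.assocR_right {C : Type u} {l m n k p : List C} (s : Shuffle l m n) (x : C)
    (t : Shuffle n k p) : s.assocR (.right x t) =
      ⟨_, .right x (s.assocR t).2.1, .right x (s.assocR t).2.2⟩ := by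
  rw [Shuffle.assocR]

theorem Shuffle.IsPull.assocR {n k p n' k' p' : List V} {t : Shuffle n k p} {f : Homs p' p}
    {t' : Shuffle n' k' p'} {f₁ : Homs n' n} {f₂ : Homs k' k} (ht : IsPull t f t' f₁ f₂) :
    ∀ {l m l' m' : List V} {s : Shuffle l m n} {s' : Shuffle l' m' n'} {g₁ : Homs l' l}
      {g₂ : Homs m' m} (_ : IsPull s f₁ s' g₁ g₂), ∃ j : Homs (s'.assocR t').1 (s.assocR t).1,
      IsPull (s.assocR t).2.2 f (s'.assocR t').2.2 g₁ j ∧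
        IsPull (s.assocR t).2.1 j (s'.assocR t').2.1 g₂ f₂ := by
  induction ht with
  | nil =>
    rintro _ _ _ _ _ _ _ _ ⟨⟩
    exact ⟨.nil, .nil, .nil⟩
  | left f _ ih =>
    intro l m l' m' s s' g₁ g₂ hs
    cases hs with
    | left _ hs =>
      obtain ⟨j, h₁, h₂⟩ := ih hs
      exact ⟨j, .left f h₁,
        h₂⟩
    | right _ hs =>
      obtain ⟨j, h₁, h₂⟩ := ih hs
      exact ⟨.cons f j, .right f h₁,
        .left f h₂⟩
  | right f _ ih =>
    intro l m l' m' s s' g₁ g₂ hs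
    obtain ⟨j, h₁, h₂⟩ := ih hs
    rw [Shuffle.assocR_right, Shuffle.assocR_right]
    exact ⟨.cons f j, .right f h₁, .right f h₂⟩

/-- The restriction of a morphism of profiles along a partial composition. -/
inductive Graft.IsPull : ∀ {c b a c' b' a' : List V} {x : V}, Graft c x b a → Homs a' a →
    Graft c' x b' a' → Homs c' c → Homs b' b → Prop
  | here {c b a c' b' a' : List V} (x : V) {y y' : V} (g : y' ⟶ y) {s : Shuffle c b a}
      {fs : Homs a' a} {s' : Shuffle c' b' a'} {f₁ : Homs c' c} {f₂ : Homs b' b}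
      (h : s.IsPull fs s' f₁ f₂) :
      IsPull (.here x y s) (.cons g fs) (.here x y' s') (.cons (𝟙 x) f₁) (.cons g f₂)
  | there {c b a c' b' a' : List V} {x y y' : V} (g : y' ⟶ y) {φ : Graft c x b a}
      {fs : Homs a' a} {φ' : Graft c' x b' a'} {f₁ : Homs c' c} {f₂ : Homs b' b}
      (h : IsPull φ fs φ' f₁ f₂) :
      IsPull (.there y φ) (.cons g fs) (.there y' φ') (.cons g f₁) f₂

theorem Graft.exists_isPull : ∀ {c b a a' : List V} {x : V} (φ : Graft c x b a) (f : Homs a' a),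
    ∃ (c' b' : List V) (φ' : Graft c' x b' a') (f₁ : Homs c' c) (f₂ : Homs b' b),
      φ.IsPull f φ' f₁ f₂
  | _, _, _, _, _, .here x y s, .cons g fs => ⟨_, _, _, _, _, .here x g (s.isPull_pull fs)⟩
  | _, _, _, _, _, .there y φ, .cons g fs => by
      obtain ⟨_, _, _, _, _, h⟩ := φ.exists_isPull fs
      exact ⟨_, _, _, _, _, .there g h⟩

/-- Changing colours does not change which part of a shuffle contains the grafted entry, so both
splittings fall into the same summand and correspond there. -/
theorem Graft.IsPull.split {n b p n' b' p' : List V} {x : V} {φ : Graft n x b p} {f : Homs p' p}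
    {φ' : Graft n' x b' p'} {f₁ : Homs n' n} {f₂ : Homs b' b} (hφ : φ.IsPull f φ' f₁ f₂) :
    ∀ {l m l' m' : List V} {s : Shuffle l m n} {s' : Shuffle l' m' n'} {g₁ : Homs l' l}
      {g₂ : Homs m' m} (_ : s.IsPull f₁ s' g₁ g₂),
      (∃ r r', s.split φ = .inl r ∧ s'.split φ' = .inl r' ∧ ∃ j : Homs r'.1 r.1,
        r.2.1.IsPull j r'.2.1 g₁ f₂ ∧ r.2.2.IsPull f r'.2.2 j g₂) ∨
      (∃ r r', s.split φ = .inr r ∧ s'.split φ' = .inr r' ∧ ∃ j : Homs r'.1 r.1,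
        r.2.1.IsPull j r'.2.1 g₂ f₂ ∧ r.2.2.IsPull f r'.2.2 g₁ j) := by
  induction hφ with
  | here x g ht =>
    intro l m l' m' s s' g₁ g₂ hs
    cases hs with
    | left _ hs =>
      obtain ⟨j, h₁, h₂⟩ := ht.assocL hs
      exact .inl ⟨_, _, rfl, rfl, .cons g j, .here x g h₂, .left g h₁⟩
    | right _ hs =>
      obtain ⟨j, h₁, h₂⟩ := ht.assocR hs
      exact .inr ⟨_, _, rfl, rfl, .cons g j, .here x g h₂, .right g h₁⟩
  | there g _ ih =>
    intro l m l' m' s s' g₁ g₂ hs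
    cases hs with
    | left _ hs =>
      obtain ⟨r, r', h, h', j, h₁, h₂⟩ | ⟨r, r', h, h', j, h₁, h₂⟩ := ih hs
      · exact .inl ⟨_, _, by rw [Shuffle.split, h], by rw [Shuffle.split, h'], .cons g j,
          .there g h₁, .left g h₂⟩
      · exact .inr ⟨_, _, by rw [Shuffle.split, h], by rw [Shuffle.split, h'], j, h₁, .left g h₂⟩
    | right _ hs =>
      obtain ⟨r, r', h, h', j, h₁, h₂⟩ | ⟨r, r', h, h', j, h₁, h₂⟩ := ih hs
      · exact .inl ⟨_, _, by rw [Shuffle.split, h], by rw [Shuffle.split, h'], j, h₁, .right g h₂⟩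
      · exact .inr ⟨_, _, by rw [Shuffle.split, h], by rw [Shuffle.split, h'], .cons g j,
          .there g h₁, .right g h₂⟩

end Pull

/-! ### Compatibility of the action with grafting, signs and the differential. -/

section Action

variable {K : Type k} [Field K] {V : Type u} [Groupoid.{v} V] {E : GroupoidModule.{u, v, w} K V}

/-- The graph of `Forest.act`. -/
inductive Forest.IsAct (E : GroupoidModule.{u, v, w} K V) : ∀ {c c' a a' : List V} {n : ℤ},
    Forest E.toColouredModule c a n → Homs a' a → Forest E.toColouredModule c' a' n →
      Homs c' c → Prop
  | nil : IsAct E .nil .nil .nil .nil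
  | leaf {c c' a a' : List V} {n : ℤ} {x x' : V} (f : x' ⟶ x)
      {F : Forest E.toColouredModule c a n} {fs : Homs a' a}
      {F' : Forest E.toColouredModule c' a' n} {k : Homs c' c} (hF : IsAct E F fs F' k) :
      IsAct E (.leaf x F) (.cons f fs) (.leaf x' F') (.cons f k)
  | graft {c c₁ c' c₁' a a₁ b b₁ a' a₁' : List V} {x y y₁ : V} {p q r n : ℤ} (e : E.obj c x p)
      (f : y₁ ⟶ y) {G : Forest E.toColouredModule c (y :: b) q}
      {F : Forest E.toColouredModule c' a r} {s : Shuffle b a a'} {fs : Homs a₁' a'}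
      {G₁ : Forest E.toColouredModule c₁ (y₁ :: b₁) q} {F₁ : Forest E.toColouredModule c₁' a₁ r}
      {s₁ : Shuffle b₁ a₁ a₁'} {f₁ : Homs b₁ b} {f₂ : Homs a₁ a} {k₁ : Homs c₁ c}
      {k₂ : Homs c₁' c'} (h : p + q + r = n) (hs : s.IsPull fs s₁ f₁ f₂)
      (hG : IsAct E G (.cons f f₁) G₁ k₁) (hF : IsAct E F f₂ F₁ k₂) :
      IsAct E (.graft e G F s h) (.cons f fs) (.graft (E.act k₁ (𝟙 x) e) G₁ F₁ s₁ h)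
        (.cons (𝟙 x) k₂)

theorem Forest.isAct_act : ∀ {c a a' : List V} {n : ℤ} (F : Forest E.toColouredModule c a n)
    (f : Homs a' a), F.IsAct E f (F.act E f).2.1 (F.act E f).2.2
  | _, _, _, _, .nil, .nil => .nil
  | _, _, _, _, .leaf _ F, .cons f fs => .leaf f (F.isAct_act fs)
  | _, _, _, _, .graft e G F s h, .cons f fs =>
      .graft e f h (s.isPull_pull fs) (G.isAct_act _) (F.isAct_act _)

theorem Forest.IsAct.act_eq {c c' a a' : List V} {n : ℤ} {F : Forest E.toColouredModule c a n}
    {f : Homs a' a} {F' : Forest E.toColouredModule c' a' n} {k : Homs c' c}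
    (h : F.IsAct E f F' k) : F.act E f = ⟨c', F', k⟩ := by
  induction h with
  | nil => rfl
  | leaf f _ ih => simp only [Forest.act]; rw [ih]
  | graft e f h hs _ _ ihG ihF => simp only [Forest.act]; rw [hs.pull_eq]; simp only; rw [ihG, ihF]

theorem Forest.IsAct.node_act {c c' a a' : List V} {p q n : ℤ}
    {F : Forest E.toColouredModule c a q}
    {f : Homs a' a} {F' : Forest E.toColouredModule c' a' q} {k : Homs c' c}
    (hF : F.IsAct E f F' k) {z z' : V} (g : z ⟶ z') (e : E.obj c z p) (h : p + q = n) :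
    (Tree.node e F h : Tree E.toColouredModule a z n).act E f g = .node (E.act k g e) F' h := by
  simp only [Tree.act]
  rw [hF.act_eq]

/-- The leaf used for grafting becomes an internal edge and receives the identity. Therefore the
morphism `k` passed on to the roots is the same before and after grafting. -/
theorem Forest.IsAct.comp {c c₁ a a₁ : List V} {p : ℤ} {F : Forest E.toColouredModule c a p}
    {f₁ : Homs a₁ a} {F₁ : Forest E.toColouredModule c₁ a₁ p} {k : Homs c₁ c}
    (hF : F.IsAct E f₁ F₁ k) : ∀ {b b' a' a₁' : List V} {x : V} {φ : Graft a x b a'}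
      {f : Homs a₁' a'} {φ₁ : Graft a₁ x b' a₁'} {f₂ : Homs b' b} (_ : φ.IsPull f φ₁ f₁ f₂)
      {q n : ℤ} (T : Tree E.toColouredModule b x q) (h : p + q = n),
      (F.comp φ T h).IsAct E f (F₁.comp φ₁ (T.act E f₂ (𝟙 x)) h) k := by
  induction hF with
  | nil => rintro _ _ _ _ _ _ _ _ _ ⟨⟩
  | leaf g hF ih =>
    intro b b' a' a₁' x φ f φ₁ f₂ hφ q n T h
    cases hφ with
    | here x g hs =>
      cases T with
      | node e G hq =>
        simp only [Forest.comp, Tree.act]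
        exact .graft e g _ hs.symm (G.isAct_act _) hF
    | there g hφ =>
      simp only [Forest.comp]
      exact .leaf g (ih hφ T h)
  | graft e g h hs hG hF ihG ihF =>
    intro b b' a' a₁' x φ f φ₁ f₂ hφ q n T hn
    cases hφ with
    | here x g ht =>
      obtain ⟨j, h₁, h₂⟩ := ht.assocL hs
      simp only [Forest.comp]
      exact .graft e g _ h₁ (ihG (.here _ g h₂) T rfl) hF
    | there g hφ =>
      obtain ⟨r, r', h, h', j, h₁, h₂⟩ | ⟨r, r', h, h', j, h₁, h₂⟩ := hφ.split hs
      · simp only [Forest.comp]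
        rw [h, h']
        exact .graft e g _ h₂ (ihG (.there g h₁) T rfl) hF
      · simp only [Forest.comp]
        rw [h, h']
        exact .graft e g _ h₂ hG (ihF h₁ T rfl)

theorem Forest.IsAct.after_eq {c c₁ a a₁ : List V} {p : ℤ} {F : Forest E.toColouredModule c a p}
    {f₁ : Homs a₁ a} {F₁ : Forest E.toColouredModule c₁ a₁ p} {k : Homs c₁ c}
    (hF : F.IsAct E f₁ F₁ k) : ∀ {b b' a' a₁' : List V} {x : V} {φ : Graft a x b a'}
      {f : Homs a₁' a'} {φ₁ : Graft a₁ x b' a₁'} {f₂ : Homs b' b} (_ : φ.IsPull f φ₁ f₁ f₂),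
      F₁.after φ₁ = F.after φ := by
  induction hF with
  | nil => rintro _ _ _ _ _ _ _ _ _ ⟨⟩
  | leaf g hF ih =>
    intro b b' a' a₁' x φ f φ₁ f₂ hφ
    cases hφ with
    | here x g hs => simp only [Forest.after]
    | there g hφ => simpa only [Forest.after] using ih hφ
  | graft e g h hs hG hF ihG ihF =>
    intro b b' a' a₁' x φ f φ₁ f₂ hφ
    cases hφ with
    | here x g ht =>
      obtain ⟨j, h₁, h₂⟩ := ht.assocL hs
      simp only [Forest.after]
      rw [ihG (.here _ g h₂)]
    | there g hφ =>
      obtain ⟨r, r', h, h', j, h₁, h₂⟩ | ⟨r, r', h, h', j, h₁, h₂⟩ := hφ.split hs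
      · simp only [Forest.after]
        rw [h, h']
        simp only [ihG (.there g h₁)]
      · simp only [Forest.after]
        rw [h, h']
        exact ihF h₁

theorem Tree.act_comp {c b a c' b' a' : List V} {x z z' : V} {φ : Graft c x b a} {f : Homs a' a}
    {φ' : Graft c' x b' a'} {f₁ : Homs c' c} {f₂ : Homs b' b} (hφ : φ.IsPull f φ' f₁ f₂)
    {p q n : ℤ} (g : z ⟶ z') (h : p + q = n) (T : Tree E.toColouredModule c z p)
    (U : Tree E.toColouredModule b x q) :
    (T.comp φ U h).act E f g = (T.act E f₁ g).comp φ' (U.act E f₂ (𝟙 x)) h := by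
  cases T with
  | node e F hF =>
    rw [(F.isAct_act f₁).node_act]
    simp only [Tree.comp]
    rw [((F.isAct_act f₁).comp hφ U rfl).node_act]

theorem Tree.act_after {c b a c' b' a' : List V} {x z z' : V} {φ : Graft c x b a} {f : Homs a' a}
    {φ' : Graft c' x b' a'} {f₁ : Homs c' c} {f₂ : Homs b' b} (hφ : φ.IsPull f φ' f₁ f₂)
    {p : ℤ} (g : z ⟶ z') (T : Tree E.toColouredModule c z p) :
    (T.act E f₁ g).after φ' = T.after φ := by
  cases T with
  | node e F hF => exact (F.isAct_act f₁).after_eq hφ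

/-- The root profile of an acted forest depends on the forest, so the second differential is not
directly the image of the first under a map between fixed types. The formal sum `L` of related
pairs, all with the same `k`, couples the two differentials term by term. -/
theorem Forest.IsAct.dTree {c c' a a' : List V} {n : ℤ} {F : Forest E.toColouredModule c a n}
    {f : Homs a' a} {F' : Forest E.toColouredModule c' a' n} {k : Homs c' c}
    (hF : F.IsAct E f F' k) :
    ∃ L : {t : Forest E.toColouredModule c a (n + 1) × Forest E.toColouredModule c' a' (n + 1) //
        t.1.IsAct E f t.2 k} →₀ K,
      F.dTree = L.mapDomain (fun t => t.1.1) ∧ F'.dTree = L.mapDomain (fun t => t.1.2) := by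
  induction hF with
  | nil => exact ⟨0, by simp [Forest.dTree], by simp [Forest.dTree]⟩
  | leaf g hF ih =>
    obtain ⟨L, h₁, h₂⟩ := ih
    refine ⟨L.mapDomain (fun t => ⟨(.leaf _ t.1.1, .leaf _ t.1.2), .leaf g t.2⟩), ?_, ?_⟩
    · rw [Forest.dTree, h₁, ← Finsupp.mapDomain_comp, ← Finsupp.mapDomain_comp]; rfl
    · rw [Forest.dTree, h₂, ← Finsupp.mapDomain_comp, ← Finsupp.mapDomain_comp]; rfl
  | @graft c c₁ c' c₁' a a₁ b b₁ a' a₁' x y y₁ p q r n e g G F s fs G₁ F₁ s₁ f₁ f₂ k₁ k₂ h hs hG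
      hF ihG ihF =>
    obtain ⟨L, h₁, h₂⟩ := ihG
    obtain ⟨L', h₁', h₂'⟩ := ihF
    refine ⟨.single ⟨(.graft (E.d e) G F s (by omega),
        .graft (E.act k₁ (𝟙 x) (E.d e)) G₁ F₁ s₁ (by omega)), .graft (E.d e) g _ hs hG hF⟩ 1
      + sgn K p • L.mapDomain (fun t => ⟨(.graft e t.1.1 F s (by omega),
        .graft (E.act k₁ (𝟙 x) e) t.1.2 F₁ s₁ (by omega)), .graft e g _ hs t.2 hF⟩)
      + sgn K (p + q) • L'.mapDomain (fun t => ⟨(.graft e G t.1.1 s (by omega),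
        .graft (E.act k₁ (𝟙 x) e) G₁ t.1.2 s₁ (by omega)), .graft e g _ hs hG t.2⟩), ?_, ?_⟩
    · rw [Forest.dTree, h₁, h₁']
      simp only [Finsupp.mapDomain_add, Finsupp.mapDomain_smul, Finsupp.mapDomain_single,
        ← Finsupp.mapDomain_comp]
      rfl
    · rw [Forest.dTree, h₂, h₂', ← E.act_d]
      simp only [Finsupp.mapDomain_add, Finsupp.mapDomain_smul, Finsupp.mapDomain_single,
        ← Finsupp.mapDomain_comp]
      rfl

theorem Tree.dTree_act {a a' : List V} {x x' : V} {n : ℤ} (f : Homs a' a) (g : x ⟶ x')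
    (T : Tree E.toColouredModule a x n) :
    (T.act E f g).dTree = T.dTree.mapDomain (Tree.act E f g) := by
  cases T with
  | node e F h =>
    have hF := F.isAct_act f
    obtain ⟨L, h₁, h₂⟩ := hF.dTree
    rw [hF.node_act, Tree.dTree, Tree.dTree, h₁, h₂]
    simp only [Finsupp.mapDomain_add, Finsupp.mapDomain_smul, Finsupp.mapDomain_single,
      ← Finsupp.mapDomain_comp]
    rw [hF.node_act, E.act_d]
    congr 3
    funext t
    exact (t.2.node_act g e _).symm

theorem formalV_act_single {a a' : List V} {x x' : V} {n : ℤ} (f : Homs a' a) (g : x ⟶ x')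
    (T : Tree E.toColouredModule a x n) (t : K) :
    (formalV E).act f g (Finsupp.single T t) = Finsupp.single (T.act E f g) t :=
  Finsupp.mapDomain_single

theorem formalV_equivariant (E : GroupoidModule.{u, v, w} K V) : (formalV E).Equivariant where
  act_d {a a' x x' n} f g α := by
    change (Finsupp.lmapDomain K K (Tree.act E f g) ∘ₗ Finsupp.linearCombination K Tree.dTree) α =
      (Finsupp.linearCombination K Tree.dTree ∘ₗ Finsupp.lmapDomain K K (Tree.act E f g)) α
    congr 1
    refine Finsupp.lhom_ext' fun T => LinearMap.ext_ring ?_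
    simp only [LinearMap.comp_apply, Finsupp.lsingle_apply, Finsupp.linearCombination_single,
      Finsupp.lmapDomain_apply, Finsupp.mapDomain_single, one_smul, Tree.dTree_act]
  act_comp {c b a a' x} φ f := by
    obtain ⟨c', b', φ', f₁, f₂, hφ⟩ := φ.exists_isPull f
    refine ⟨c', b', φ', f₁, f₂, fun {z z' p q n} g h α β => ?_⟩
    have key : ((formalV E).comp φ h).compr₂ ((formalV E).act f g) =
        ((formalV E).comp φ' h).compl₁₂ ((formalV E).act f₁ g) ((formalV E).act f₂ (𝟙 x)) := by
      refine Finsupp.lhom_ext' fun T => LinearMap.ext_ring (Finsupp.lhom_ext' fun U =>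
        LinearMap.ext_ring ?_)
      change (formalV E).act f g ((formal _).comp φ h (Finsupp.single T 1) (Finsupp.single U 1)) =
        (formal _).comp φ' h ((formalV E).act f₁ g (Finsupp.single T 1))
          ((formalV E).act f₂ (𝟙 x) (Finsupp.single U 1))
      rw [formal_comp_single, formalV_act_single, formalV_act_single, formalV_act_single,
        formal_comp_single, Tree.act_comp hφ, Tree.act_after hφ]
    exact LinearMap.congr_fun (LinearMap.congr_fun key α) β

end Action

/-! ### Compatibility of the action with edge moves. -/

section ActionOnSteps

variable {K : Type k} [Field K] {V : Type u} [Groupoid.{v} V] {E : GroupoidModule.{u, v, w} K V}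
  {N : Subgroupoid V}

/-- The morphism `f` is nontrivial only at a tree with a vertex, while `k` is nontrivial only at
bare leaves. They do not interfere, and the commuting square is what the vertex below the edge
needs. -/
theorem Forest.Move.act {c c' a : List V} {n : ℤ} {G : Forest E.toColouredModule c' a n}
    {f : Homs c' c} {G' : Forest E.toColouredModule c a n} (hG : G.Move E N f G') :
    ∀ {a₁ c₁' : List V} {j : Homs a₁ a} {G₁ : Forest E.toColouredModule c₁' a₁ n} {k : Homs c₁' c'}
      (_ : G.IsAct E j G₁ k), ∃ (c₁ : List V) (f₁ : Homs c₁' c₁)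
      (G₁' : Forest E.toColouredModule c₁ a₁ n) (k' : Homs c₁ c), G₁.Move E N f₁ G₁' ∧
        G'.IsAct E j G₁' k' ∧ k.comp f = f₁.comp k' := by
  induction hG with
  | head g hg e G F s h =>
    intro a₁ c₁' j G₁ k hj
    cases hj with
    | @graft _ _ _ _ _ _ _ _ _ _ _ _ _ _ _ _ _ _ f _ _ _ _ _ _ _ _ _ k₁ k₂ h hs hG hF =>
      refine ⟨_, _, _, .cons (𝟙 _) k₂, .head g hg _ _ _ _ _, ?_, ?_⟩
      · have := Forest.IsAct.graft (E.act (Homs.id _) g e) f h hs hG hF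
        rw [E.act_comp, Homs.comp_id, Category.comp_id] at this
        rw [E.act_comp, Homs.id_comp, Category.id_comp]
        exact this
      · simp only [Homs.comp, Homs.comp_id, Homs.id_comp, Category.comp_id, Category.id_comp]
  | leaf x _ ih =>
    intro a₁ c₁' j G₁ k hj
    cases hj with
    | leaf f hj =>
      obtain ⟨c₁, f₁, G₁', k', h₁, h₂, h₃⟩ := ih hj
      exact ⟨_, _, _, _, .leaf _ h₁, .leaf f h₂, by
        simp only [Homs.comp, h₃, Category.comp_id, Category.id_comp]⟩
  | tail e G s h _ ih =>
    intro a₁ c₁' j G₁ k hj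
    cases hj with
    | graft _ f _ hs hG hF =>
      obtain ⟨c₁, f₁, G₁', k', h₁, h₂, h₃⟩ := ih hF
      exact ⟨_, _, _, _, .tail _ _ _ _ h₁, .graft e f h hs hG h₂, by
        simp only [Homs.comp, h₃]⟩

theorem Forest.Step.act {c a : List V} {n : ℤ} {F F' : Forest E.toColouredModule c a n}
    (hF : F.Step E N F') :
    ∀ {a₁ c₁ : List V} {j : Homs a₁ a} {F₁ : Forest E.toColouredModule c₁ a₁ n} {k : Homs c₁ c}
      (_ : F.IsAct E j F₁ k), ∃ F₁' : Forest E.toColouredModule c₁ a₁ n,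
        F₁.Step E N F₁' ∧ F'.IsAct E j F₁' k := by
  induction hF with
  | edge e F s h hG =>
    intro a₁ c₁ j F₁ k hj
    cases hj with
    | graft _ f _ hs hG₁ hF₁ =>
      obtain ⟨c₁, f₁, G₁', k', h₁, h₂, h₃⟩ := hG.act hG₁
      refine ⟨_, ?_, .graft e f h hs h₂ hF₁⟩
      -- By the square, acting by `f` and then `k` on the lower vertex is acting by `k'` and then
      -- `f₁`; the outer action by `f₁` is the new edge move.
      rw [E.act_comp, h₃, Category.comp_id, ← Category.comp_id (𝟙 _), ← E.act_comp,
        Category.comp_id]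
      exact .edge _ _ _ _ h₁
  | leaf x _ ih =>
    intro a₁ c₁ j F₁ k hj
    cases hj with
    | leaf f hj =>
      obtain ⟨F₁', h₁, h₂⟩ := ih hj
      exact ⟨_, .leaf _ h₁, .leaf f h₂⟩
  | sub e F s h _ ih =>
    intro a₁ c₁ j F₁ k hj
    cases hj with
    | graft _ f _ hs hG hF =>
      obtain ⟨G₁', h₁, h₂⟩ := ih hG
      exact ⟨_, .sub _ _ _ _ h₁, .graft e f h hs h₂ hF⟩
  | tail e G s h _ ih =>
    intro a₁ c₁ j F₁ k hj
    cases hj with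
    | graft _ f _ hs hG hF =>
      obtain ⟨F₁', h₁, h₂⟩ := ih hF
      exact ⟨_, .tail _ _ _ _ h₁, .graft e f h hs hG h₂⟩

theorem Tree.Step.act {a a' : List V} {x x' : V} {n : ℤ} {T T' : Tree E.toColouredModule a x n}
    (hT : T.Step E N T') (f : Homs a' a) (g : x ⟶ x') :
    (T.act E f g).Step E N (T'.act E f g) := by
  cases hT with
  | @edge _ _ _ _ _ _ _ e G _ _ h hG =>
    obtain ⟨c₁, f₁, G₁', k', h₁, h₂, h₃⟩ := hG.act (G.isAct_act f)
    rw [(G.isAct_act f).node_act, h₂.node_act, E.act_comp, h₃, Category.id_comp,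
      ← Category.comp_id g, ← E.act_comp, Category.comp_id]
    exact .edge _ _ h₁
  | @sub _ _ _ _ _ _ e G _ h hG =>
    obtain ⟨G₁', h₁, h₂⟩ := hG.act (G.isAct_act f)
    rw [(G.isAct_act f).node_act, h₂.node_act]
    exact .sub _ _ h₁

theorem Forest.isAct_leaves : ∀ {c c' : List V} (f : Homs c' c),
    (Forest.leaves (M := E.toColouredModule) c).IsAct E f (Forest.leaves c') f
  | _, _, .nil => .nil
  | _, _, .cons f fs => .leaf f (Forest.isAct_leaves fs)

theorem Tree.corolla_act {c c' : List V} {x x' : V} {p : ℤ} (f : Homs c' c) (g : x ⟶ x')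
    (e : E.obj c x p) :
    (Tree.corolla (M := E.toColouredModule) e).act E f g = Tree.corolla (E.act f g e) :=
  (Forest.isAct_leaves f).node_act g e _

end ActionOnSteps

/-! ### Classes of two-vertex trees -/

section TwoVertices

variable {K : Type k} [Field K] {V : Type u} [Groupoid.{v} V] {E : GroupoidModule.{u, v, w} K V}
  {N : Subgroupoid V}

/-- The number of vertices of a forest. -/
def Forest.vertices {C : Type u} {M : ColouredModule.{u, w} K C} :
    {c a : List C} → {n : ℤ} → Forest M c a n → ℕ
  | _, _, _, .nil => 0
  | _, _, _, .leaf _ F => F.vertices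
  | _, _, _, .graft _ G F _ _ => G.vertices + F.vertices + 1

/-- The number of vertices of a tree. -/
def Tree.vertices {C : Type u} {M : ColouredModule.{u, w} K C} {a : List C} {x : C} {n : ℤ} :
    Tree M a x n → ℕ
  | .node _ F _ => F.vertices + 1

theorem Forest.Move.vertices_eq {c c' a : List V} {n : ℤ} {G : Forest E.toColouredModule c' a n}
    {f : Homs c' c} {G' : Forest E.toColouredModule c a n} (h : G.Move E N f G') :
    G'.vertices = G.vertices := by
  induction h with
  | head => rfl
  | leaf x _ ih => exact ih
  | tail e G s h _ ih => simp only [Forest.vertices, ih]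

theorem Forest.Move.vertices_pos {c c' a : List V} {n : ℤ} {G : Forest E.toColouredModule c' a n}
    {f : Homs c' c} {G' : Forest E.toColouredModule c a n} (h : G.Move E N f G') :
    0 < G.vertices := by
  induction h with
  | head => exact Nat.succ_pos _
  | leaf x _ ih => exact ih
  | tail e G s h _ ih => exact Nat.succ_pos _

theorem Forest.Step.vertices_eq {c a : List V} {n : ℤ} {F F' : Forest E.toColouredModule c a n}
    (h : F.Step E N F') : F'.vertices = F.vertices := by
  induction h with
  | edge e F s h hG => simp only [Forest.vertices, hG.vertices_eq]
  | leaf x _ ih => exact ih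
  | sub e F s h _ ih => simp only [Forest.vertices, ih]
  | tail e G s h _ ih => simp only [Forest.vertices, ih]

theorem Forest.Step.one_lt_vertices {c a : List V} {n : ℤ}
    {F F' : Forest E.toColouredModule c a n} (h : F.Step E N F') : 1 < F.vertices := by
  induction h with
  | edge e F s h hG =>
    have := hG.vertices_pos
    simp only [Forest.vertices]
    omega
  | leaf x _ ih => exact ih
  | sub e F s h _ ih => simp only [Forest.vertices]; omega
  | tail e G s h _ ih => simp only [Forest.vertices]; omega

theorem Tree.Step.vertices_eq {a : List V} {x : V} {n : ℤ} {T T' : Tree E.toColouredModule a x n}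
    (h : T.Step E N T') : T'.vertices = T.vertices := by
  cases h with
  | edge e h hG => simp only [Tree.vertices, hG.vertices_eq]
  | sub e h hG => simp only [Tree.vertices, hG.vertices_eq]

theorem Forest.Move.symm {c c' a : List V} {n : ℤ} {G : Forest E.toColouredModule c' a n}
    {f : Homs c' c} {G' : Forest E.toColouredModule c a n} (h : G.Move E N f G') :
    ∃ f' : Homs c c', G'.Move E N f' G ∧ f'.comp f = Homs.id c := by
  induction h with
  | head g hg e G F s h =>
    refine ⟨.cons (Groupoid.inv g) (Homs.id _), ?_, ?_⟩
    · have := Forest.Move.head (E := E) (N := N) (Groupoid.inv g) (N.inv hg)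
        (E.act (Homs.id _) g e) G F s h
      rw [E.act_comp, Homs.id_comp, Groupoid.comp_inv, E.act_id] at this
      exact this
    · rw [Homs.comp, Groupoid.inv_comp, Homs.id_comp, Homs.id]
  | leaf x _ ih =>
    obtain ⟨f', h₁, h₂⟩ := ih
    exact ⟨_, .leaf x h₁, by rw [Homs.comp, Category.id_comp, h₂, Homs.id]⟩
  | tail e G s h _ ih =>
    obtain ⟨f', h₁, h₂⟩ := ih
    exact ⟨_, .tail e G s h h₁, by rw [Homs.comp, Category.id_comp, h₂, Homs.id]⟩

theorem Forest.Step.symm {c a : List V} {n : ℤ} {F F' : Forest E.toColouredModule c a n}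
    (h : F.Step E N F') : F'.Step E N F := by
  induction h with
  | @edge _ _ _ _ _ _ x _ _ _ _ _ e _ f _ F s h hG =>
    obtain ⟨f', h₁, h₂⟩ := hG.symm
    have := Forest.Step.edge (E.act f (𝟙 x) e) F s h h₁
    rw [E.act_comp, h₂, Category.comp_id, E.act_id] at this
    exact this
  | leaf x _ ih => exact .leaf x ih
  | sub e F s h _ ih => exact .sub e F s h ih
  | tail e G s h _ ih => exact .tail e G s h ih

theorem Tree.Step.symm {a : List V} {x : V} {n : ℤ} {T T' : Tree E.toColouredModule a x n}
    (h : T.Step E N T') : T'.Step E N T := by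
  cases h with
  | @edge _ _ _ _ _ _ _ e _ f _ h hG =>
    obtain ⟨f', h₁, h₂⟩ := hG.symm
    have := Tree.Step.edge (E.act f (𝟙 x) e) h h₁
    rw [E.act_comp, h₂, Category.comp_id, E.act_id] at this
    exact this
  | sub e h hG => exact .sub e h hG.symm

/-- With a single vertex there is only one place to move, so the two morphisms meet at the same tree
and compose in `N`. -/
theorem Forest.Move.trans {c c' a : List V} {n : ℤ} {G : Forest E.toColouredModule c' a n}
    {f : Homs c' c} {G' : Forest E.toColouredModule c a n} (h : G.Move E N f G') :
    ∀ {c'' : List V} {f' : Homs c c''} {G'' : Forest E.toColouredModule c'' a n}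
      (_ : G'.Move E N f' G'') (_ : G.vertices = 1), G.Move E N (f.comp f') G'' := by
  induction h with
  | head g hg e G F s h =>
    intro c'' f' G'' h' hv
    cases h' with
    | head g' hg' =>
      rw [E.act_comp, Homs.id_comp, Homs.comp, Homs.id_comp]
      exact .head _ (N.mul hg hg') e G F s h
    | tail _ _ _ _ h' =>
      have := h'.vertices_pos
      simp only [Forest.vertices] at hv
      omega
  | leaf x _ ih =>
    intro c'' f' G'' h' hv
    cases h' with
    | leaf _ h' =>
      rw [Homs.comp, Category.comp_id]
      exact .leaf x (ih h' hv)
  | tail e G s h hF =>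
    intro c'' f' G'' h' hv
    have := hF.vertices_pos
    simp only [Forest.vertices] at hv
    omega

theorem Tree.Step.trans {a : List V} {x : V} {n : ℤ} {T T' T'' : Tree E.toColouredModule a x n}
    (h : T.Step E N T') (h' : T'.Step E N T'') (hT : T.vertices = 2) : T.Step E N T'' := by
  have hT' := h.vertices_eq.trans hT
  cases h' with
  | sub _ _ hG =>
    have := hG.one_lt_vertices
    simp only [Tree.vertices] at hT'
    omega
  | edge e h₀ hG' =>
    cases h with
    | sub _ _ hG =>
      have := hG.one_lt_vertices
      simp only [Tree.vertices] at hT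
      omega
    | edge _ _ hG =>
      rw [E.act_comp, Category.comp_id]
      exact .edge e h₀ (hG.trans hG' (by simpa [Tree.vertices] using hT))

/-- On two-vertex trees the moves are already symmetric and transitive, so the generated equivalence
adds only reflexivity. -/
theorem Tree.step_of_eqvGen {a : List V} {x : V} {n : ℤ} {T T' : Tree E.toColouredModule a x n}
    (h : Relation.EqvGen (Tree.Step E N) T T') :
    T'.vertices = T.vertices ∧ (T.vertices = 2 → T = T' ∨ T.Step E N T') := by
  induction h with
  | rel _ _ h => exact ⟨h.vertices_eq, fun _ => .inr h⟩
  | refl _ => exact ⟨rfl, fun _ => .inl rfl⟩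
  | symm _ _ _ ih =>
    refine ⟨ih.1.symm, fun h => ?_⟩
    obtain rfl | h' := ih.2 (ih.1.symm.trans h)
    · exact .inl rfl
    · exact .inr h'.symm
  | trans _ _ _ _ _ ih ih' =>
    refine ⟨ih'.1.trans ih.1, fun h => ?_⟩
    obtain rfl | h₁ := ih.2 h
    · exact ih'.2 h
    obtain rfl | h₂ := ih'.2 (ih.1.trans h)
    · exact .inr h₁
    · exact .inr (h₁.trans h₂ h)

theorem Forest.finite_move (hfin : ∀ x : V, Finite ((y : V) × N.arrows x y)) {c a : List V} {n : ℤ}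
    (G : Forest E.toColouredModule c a n) :
    {t : (c' : List V) × Homs c' c × Forest E.toColouredModule c' a n |
      t.2.2.Move E N t.2.1 G}.Finite := by
  induction G with
  | nil =>
    convert Set.finite_empty
    ext ⟨c', f, G'⟩
    simp only [Set.mem_ofPred_eq, Set.mem_empty_iff_false, iff_false]
    rintro ⟨⟩
  | leaf x F ih =>
    refine (ih.image fun t => ⟨x :: t.1, .cons (𝟙 x) t.2.1, .leaf x t.2.2⟩).subset ?_
    rintro ⟨c', f, G'⟩ h
    cases h with
    | leaf _ h => exact ⟨⟨_, _, _⟩, h, rfl⟩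
  | @graft c c' a b a' x y p q r n e G F s h _ ih =>
    have := hfin x
    -- A move ending at a root of colour `x` is made by some `g : x' ⟶ x`. Its inverse is a morphism
    -- of `N` with source `x`, of which there are finitely many, and it recovers the original
    -- decoration.
    refine ((Set.finite_range fun t : (y : V) × N.arrows x y =>
      (⟨t.1 :: c', .cons (Groupoid.inv t.2.1) (Homs.id c'),
        .graft (E.act (Homs.id c) t.2.1 e) G F s h⟩ :
        (c₁ : List V) × Homs c₁ (x :: c') × Forest E.toColouredModule c₁ (y :: a') n)).union
      (ih.image fun t => ⟨x :: t.1, .cons (𝟙 x) t.2.1, .graft e G t.2.2 s h⟩)).subset ?_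
    rintro ⟨c', f, G'⟩ h
    cases h with
    | head g hg e =>
      refine .inl ⟨⟨_, Groupoid.inv g, N.inv hg⟩, ?_⟩
      simp only
      rw [E.act_comp, Homs.id_comp, Groupoid.comp_inv, E.act_id, Groupoid.inv_eq_inv,
        Groupoid.inv_eq_inv, IsIso.inv_inv]
    | tail _ _ _ _ h => exact .inr ⟨⟨_, _, _⟩, h, rfl⟩

theorem Tree.finite_class (hfin : ∀ x : V, Finite ((y : V) × N.arrows x y)) {a : List V} {x : V}
    {n : ℤ} (T : Tree E.toColouredModule a x n) (hT : T.vertices = 2) :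
    {T' | Relation.EqvGen (Tree.Step E N) T T'}.Finite := by
  cases T with
  | @node c _ _ p q _ e G h =>
    refine (((G.finite_move hfin).image fun t =>
      Tree.node (E.act t.2.1 (𝟙 x) e) t.2.2 h).insert (.node e G h)).subset fun T' hT' => ?_
    obtain rfl | h' := (Tree.step_of_eqvGen hT').2 hT
    · exact .inl rfl
    -- Finiteness is known for the moves that end at a given forest, so the step is reversed to end
    -- at the given tree.
    · have hs := h'.symm
      clear h' hT'
      cases hs with
      | sub _ _ hG =>
        have := hG.symm.one_lt_vertices
        simp only [Tree.vertices] at hT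
        omega
      | edge _ _ hG => exact .inr ⟨⟨_, _, _⟩, hG, rfl⟩

variable {S : ∀ c x n, Set (E.obj c x n)} {a : List V} {x : V} {n : ℤ}
  [LinearOrder (Monomial E S a x n)]

/-- True also for the default value, where no least element exists. For trees with more than two
vertices nothing else about `star` is used. -/
theorem Monomial.star_mem_orbit (T : Monomial E S a x n) : T.star N ∈ T.orbit N := by
  unfold Monomial.star
  split_ifs with h
  · exact h.choose_spec.1
  · exact .refl _

/-- Both representatives are the least element of one and the same class. Finiteness guarantees that
this element exists; the default values would differ. -/
theorem Monomial.star_eq_of_step (hfin : ∀ x : V, Finite ((y : V) × N.arrows x y))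
    {T T' : Monomial E S a x n} (h : T.1.Step E N T'.1) (hT : T.1.vertices = 2) :
    T.star N = T'.star N := by
  have horb : T.orbit N = T'.orbit N := Set.ext fun U =>
    ⟨fun hU => .trans _ _ _ (.symm _ _ (.rel _ _ h)) hU, fun hU => .trans _ _ _ (.rel _ _ h) hU⟩
  have hF : (T.orbit N).Finite :=
    (T.1.finite_class hfin hT).preimage Subtype.val_injective.injOn
  obtain ⟨U, hU, hmin⟩ := Set.exists_min_image _ id hF ⟨T, .refl _⟩
  have hex : ∃ U, IsLeast (T.orbit N) U := ⟨U, hU, fun W hW => hmin W hW⟩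
  have hex' : ∃ U, IsLeast (T'.orbit N) U := horb ▸ hex
  rw [Monomial.star, Monomial.star, dif_pos hex, dif_pos hex']
  have hW := hex.choose_spec
  generalize hex.choose = W at hW ⊢
  rw [horb] at hW
  exact hW.unique hex'.choose_spec

end TwoVertices

/-! ### Comparison of the two presentations -/

section Comparison

variable {K : Type k} [Field K] {C : Type u} {V : Type u} [Groupoid.{v} V]

theorem Tree.corolla_comp_corolla {M : ColouredModule.{u, w} K C} {d c b a : List C} {x y z : C}
    {p q m n : ℤ} (e₀ : M.obj (d.reverseAux (x :: c)) z p) (e : M.obj (y :: b) x q)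
    (s : Shuffle b c a) (h : q + 0 + 0 = m) (h₀ : p + m = n) (hn : p + q = n) :
    (Tree.corolla e₀).comp ((Graft.here x y s.symm).pre d) (Tree.corolla e) hn =
      .node e₀ ((Forest.graft e (Forest.leaves (y :: b)) (Forest.leaves c) s h).pre d) h₀ := by
  obtain rfl : m = 0 + q := by omega
  simp only [Tree.corolla, Tree.comp]
  rw [← Forest.pre_leaves (x :: c) d, Forest.pre_comp, Forest.leaves.eq_2 x c,
    Forest.leaf_comp_here e _ _ s h]

theorem Forest.leaves_after {M : ColouredModule.{u, w} K C} : ∀ {c b a : List C} {x : C}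
    (φ : Graft c x b a), (Forest.leaves (M := M) c).after φ = 0
  | _, _, _, _, .here _ _ _ => by rw [Forest.leaves, Forest.after]
  | _, _, _, _, .there _ φ => by rw [Forest.leaves, Forest.after, Forest.leaves_after φ]

/-- No vertex follows a leaf of a corolla, so two corollas compose without sign. -/
theorem Tree.corolla_after {M : ColouredModule.{u, w} K C} {c b a : List C} {x z : C} {p : ℤ}
    (e : M.obj c z p) (φ : Graft c x b a) : (Tree.corolla e).after φ = 0 :=
  Forest.leaves_after φ

theorem Forest.vertices_leaves {M : ColouredModule.{u, w} K C} :
    ∀ c : List C, (Forest.leaves (M := M) c).vertices = 0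
  | [] => rfl
  | _ :: c => Forest.vertices_leaves c

theorem Forest.vertices_pre {M : ColouredModule.{u, w} K C} (d : List C) {c a : List C} {n : ℤ}
    (F : Forest M c a n) : (F.pre d).vertices = F.vertices := by
  induction d generalizing c a with
  | nil => rfl
  | cons y d ih => exact ih (.leaf y F)

theorem Forest.all_leaves {M : ColouredModule.{u, w} K C} (S : ∀ c x n, Set (M.obj c x n)) :
    ∀ c : List C, (Forest.leaves (M := M) c).All S
  | [] => trivial
  | _ :: c => Forest.all_leaves S c

theorem Forest.All.pre {M : ColouredModule.{u, w} K C} {S : ∀ c x n, Set (M.obj c x n)}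
    (d : List C) {c a : List C} {n : ℤ} {F : Forest M c a n} (hF : F.All S) : (F.pre d).All S := by
  induction d generalizing c a with
  | nil => exact hF
  | cons y d ih => exact ih (F := .leaf y F) hF

variable {E : GroupoidModule.{u, v, w} K V} {N : Subgroupoid V}

theorem Forest.Move.pre (d : List V) {c c' a : List V} {n : ℤ}
    {G : Forest E.toColouredModule c' a n} {f : Homs c' c} {G' : Forest E.toColouredModule c a n}
    (h : G.Move E N f G') : (G.pre d).Move E N (f.pre d) (G'.pre d) := by
  induction d generalizing c c' a with
  | nil => exact h
  | cons y d ih => exact ih (.leaf y h)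

/-- The linear map that sends a decoration to the class of its corolla. -/
noncomputable def free.corolla (M : ColouredModule.{u, w} K C) (c : List C) (x : C) (p : ℤ) :
    M.obj c x p →ₗ[K] (free M).obj c x p where
  toFun e := free.mk (Tree.corolla e)
  map_add' e e' := by
    have h := Ideal.subset_gen (P := formal M) (Multilinear M) (.add e e')
    exact (Submodule.Quotient.eq _).2 h
  map_smul' l e := by
    have h := Ideal.subset_gen (P := formal M) (Multilinear M) (.smul l e)
    exact (Submodule.Quotient.eq _).2 h

theorem free.mk_eq_proj {M : ColouredModule.{u, w} K C} {a : List C} {x : C} {n : ℤ}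
    (T : Tree M a x n) : free.mk T =
      ((formal M).proj (Ideal.gen (Multilinear M))).map a x n (Finsupp.single T 1) :=
  rfl

theorem free.comp_mk {M : ColouredModule.{u, w} K C} {c b a : List C} {x z : C} {p q n : ℤ}
    (φ : Graft c x b a) (h : p + q = n) (T : Tree M c z p) (U : Tree M b x q)
    (hφ : T.after φ = 0) :
    (free M).comp φ h (free.mk T) (free.mk U) = free.mk (T.comp φ U h) := by
  rw [free.mk_eq_proj, free.mk_eq_proj, free.mk_eq_proj]
  refine (((formal M).proj (Ideal.gen (Multilinear M))).map_comp φ h _ _).symm.trans ?_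
  rw [formal_comp_single, hφ, mul_zero]
  simp [sgn]

variable {S : ∀ c x n, Set (E.obj c x n)} [∀ a x n, LinearOrder (Monomial E S a x n)]
  {Q : Operad.{u, max u w k} K V}

theorem Operad.Hom.congr_iff {P : Operad.{u, max u w k} K C} {M : ColouredModule.{u, w} K C}
    (π : (formal M).Hom P) {a : List C} {x : C} {n : ℤ} {T T' : Tree M a x n} :
    π.ker.Congr T T' ↔
      π.map a x n (Finsupp.single T 1) = π.map a x n (Finsupp.single T' 1) := by
  refine π.mem_ker.trans ?_
  exact (congrArg (· = 0) (map_sub (π.map a x n) _ _)).to_iff.trans sub_eq_zero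

/-- A quotient of the free operad in which the relations `E_*²` hold identifies the two-vertex trees
that arise from each other by the action of a morphism on the internal edge. -/
theorem identifiesEdges_of_edgeRelations (hfin : ∀ x : V, Finite ((y : V) × N.arrows x y))
    (hspan : ∀ c x n, Submodule.span K (S c x n) = ⊤)
    (hact : ∀ (c c' : List V) (x x' : V) (n : ℤ) (f : Homs c' c) (g : x ⟶ x'),
      ∀ e ∈ S c x n, E.act f g e ∈ S c' x' n)
    (π : (free E.toColouredModule).Hom Q)
    (hπ : ∀ a x n, edgeRelations N E S a x n ⊆ π.ker.carrier a x n) :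
    (((formal E.toColouredModule).proj (Ideal.gen (Multilinear _))).trans
      π).ker.IdentifiesEdges N := by
  intro c b a x x' y z p q m n d g hg e₀ e s h h₀
  have hn : p + q = n := by omega
  set f := Homs.pre d (.cons g (Homs.id c)) with hf
  set φ := (Graft.here x y s.symm).pre d with hφ
  set φ' := (Graft.here x' y s.symm).pre d with hφ'
  -- Both ends of the move are bilinear in the pair of decorations, so they need to be compared only
  -- on the spanning set `S`.
  let B := ((free E.toColouredModule).comp φ' hn).compl₁₂
    ((free.corolla E.toColouredModule _ z p).comp (E.act f (𝟙 z)))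
    (free.corolla E.toColouredModule (y :: b) x' q)
  let B' := ((free E.toColouredModule).comp φ hn).compl₁₂ (free.corolla E.toColouredModule _ z p)
    ((free.corolla E.toColouredModule (y :: b) x q).comp (E.act (Homs.id (y :: b)) g))
  have hB : B.compr₂ (π.map _ z n) = B'.compr₂ (π.map _ z n) := by
    refine LinearMap.ext_on (hspan _ _ _) fun e₀ he₀ =>
      LinearMap.ext_on (hspan _ _ _) fun e he => ?_
    -- Stability of `S` under `V` makes both ends of the move tree monomials.
    have he₀' := hact _ _ _ _ _ f (𝟙 z) e₀ he₀
    have he' := hact _ _ _ _ _ (Homs.id (y :: b)) g e he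
    let T : Monomial E S (d.reverseAux (y :: a)) z n := ⟨.node (E.act f (𝟙 z) e₀)
      ((Forest.graft e (Forest.leaves (y :: b)) (Forest.leaves c) s h).pre d) h₀,
      he₀', Forest.All.pre d ⟨he, Forest.all_leaves S _, Forest.all_leaves S _⟩⟩
    let T' : Monomial E S (d.reverseAux (y :: a)) z n := ⟨.node e₀
      ((Forest.graft (E.act (Homs.id (y :: b)) g e) (Forest.leaves (y :: b))
        (Forest.leaves c) s h).pre d) h₀,
      he₀, Forest.All.pre d ⟨he', Forest.all_leaves S _, Forest.all_leaves S _⟩⟩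
    have hT : T.star N = T'.star N := by
      refine Monomial.star_eq_of_step hfin
        (.edge e₀ h₀ (Forest.Move.pre d (.head g hg e _ _ s h))) ?_
      simp only [T, Tree.vertices]
      rw [Forest.vertices_pre, Forest.vertices, Forest.vertices_leaves, Forest.vertices_leaves]
    -- Each end is a composite of corollas, identified by its relation in `E_*²` with its minimal
    -- representative; these representatives coincide by `hT`.
    have h₁ := hπ _ _ _ ⟨_, _, _, _, _, φ', hn, E.act f (𝟙 z) e₀, e, T, he₀', he,
      (Tree.corolla_comp_corolla (M := E.toColouredModule) _ e s h h₀ hn).symm, rfl⟩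
    have h₂ := hπ _ _ _ ⟨_, _, _, _, _, φ, hn, e₀, E.act (Homs.id (y :: b)) g e, T', he₀, he',
      (Tree.corolla_comp_corolla (M := E.toColouredModule) e₀ _ s h h₀ hn).symm, rfl⟩
    rw [SetLike.mem_coe, Operad.Hom.mem_ker, map_sub, sub_eq_zero] at h₁ h₂
    rw [← hT] at h₂
    exact h₁.trans h₂.symm
  rw [Operad.Hom.congr_iff]
  have key := LinearMap.congr_fun (LinearMap.congr_fun hB e₀) e
  have hB₁ : B e₀ e = free.mk (Tree.node (E.act f (𝟙 z) e₀)
      ((Forest.graft e (Forest.leaves (y :: b)) (Forest.leaves c) s h).pre d) h₀) :=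
    (free.comp_mk _ _ _ _ (Tree.corolla_after (M := E.toColouredModule) _ _)).trans
      (congrArg free.mk (Tree.corolla_comp_corolla (M := E.toColouredModule) _ e s h h₀ hn))
  have hB₂ : B' e₀ e = free.mk (Tree.node e₀
      ((Forest.graft (E.act (Homs.id (y :: b)) g e) (Forest.leaves (y :: b))
        (Forest.leaves c) s h).pre d) h₀) :=
    (free.comp_mk _ _ _ _ (Tree.corolla_after (M := E.toColouredModule) _ _)).trans
      (congrArg free.mk (Tree.corolla_comp_corolla (M := E.toColouredModule) e₀ _ s h h₀ hn))
  rw [LinearMap.compr₂_apply, LinearMap.compr₂_apply, hB₁, hB₂] at key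
  exact key

/-- The relations that define the free `V`-coloured operad. -/
def freeVRelations (N : Subgroupoid V) (E : GroupoidModule.{u, v, w} K V) (a : List V) (x : V)
    (n : ℤ) : Set ((formalV E).obj a x n) :=
  Multilinear E.toColouredModule a x n ∪
    {ρ | ∃ T T' : Tree E.toColouredModule a x n, T.Step E N T' ∧
      ρ = .single T 1 - .single T' 1}

theorem freeVRelations_act {a a' : List V} {x x' : V} {n : ℤ} (f : Homs a' a) (g : x ⟶ x')
    {ρ : (formalV E).obj a x n} (hρ : ρ ∈ freeVRelations N E a x n) :
    (formalV E).act f g ρ ∈ freeVRelations N E a' x' n := by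
  obtain hρ | ⟨T, T', hT, rfl⟩ := hρ
  · left
    cases hρ with
    | add e e' =>
      have := Multilinear.add (E.act f g e) (E.act f g e')
      rw [← map_add] at this
      simp only [← Tree.corolla_act] at this
      convert this
      erw [map_sub, map_add, formalV_act_single, formalV_act_single, formalV_act_single]
      rfl
    | smul l e =>
      have := Multilinear.smul l (E.act f g e)
      rw [← map_smul] at this
      simp only [← Tree.corolla_act] at this
      convert this
      erw [map_sub, map_smul, formalV_act_single, formalV_act_single]
      rfl
  · refine .inr ⟨_, _, hT.act f g, ?_⟩
    erw [map_sub, formalV_act_single, formalV_act_single]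

/-- The ideal that defines the free `V`-coloured operad. -/
noncomputable def freeVIdeal (N : Subgroupoid V) (E : GroupoidModule.{u, v, w} K V) :
    GroupoidIdeal (formalV E) :=
  GroupoidIdeal.gen (freeVRelations N E)

/-- The kernel of `π` is not assumed stable under `V`. This costs nothing, because the relations are
stable and generate the same ideal with or without the action. -/
theorem freeVIdeal_le {π : (formal E.toColouredModule).Hom Q} (hI : π.ker.IdentifiesEdges N)
    (hπ : ∀ a x n, Multilinear E.toColouredModule a x n ⊆ π.ker.carrier a x n)
    (a : List V) (x : V) (n : ℤ) : (freeVIdeal N E).carrier a x n ≤ π.ker.carrier a x n := by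
  refine ((formalV_equivariant E).gen_le (fun a a' x x' n f g r hr =>
    Ideal.subset_gen (P := (formalV E).toOperad) _ (freeVRelations_act f g hr)) a x n).trans
      (Ideal.gen_le _ ?_ a x n)
  rintro a x n ρ (hρ | ⟨T, T', hT, rfl⟩)
  · exact hπ a x n hρ
  · exact hI.congr_step hT

/-- The projection to the free `V`-coloured operad. -/
noncomputable def freeV.proj (N : Subgroupoid V) (E : GroupoidModule.{u, v, w} K V) :
    (formal E.toColouredModule).Hom (freeV N E).toOperad :=
  (formal E.toColouredModule).proj (freeVIdeal N E).toIdeal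

theorem freeV.mem_ker_proj {a : List V} {x : V} {n : ℤ}
    {α : (formal E.toColouredModule).obj a x n} :
    α ∈ (freeV.proj N E).ker.carrier a x n ↔ α ∈ (freeVIdeal N E).carrier a x n :=
  (freeV.proj N E).mem_ker.trans (Operad.proj_eq_zero (freeVIdeal N E).toIdeal)

/-- The morphism from the free `ob(V)`-coloured operad to the free `V`-coloured operad. -/
noncomputable def free.toFreeV (N : Subgroupoid V) (E : GroupoidModule.{u, v, w} K V) :
    (free E.toColouredModule).Hom (freeV N E).toOperad :=
  (freeV.proj N E).desc _ (Ideal.gen_le _ fun _ _ _ _ hρ =>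
    freeV.mem_ker_proj.2 (GroupoidIdeal.subset_gen (freeVRelations N E) (.inl hρ)))

theorem free.toFreeV_mk {a : List V} {x : V} {n : ℤ} (T : Tree E.toColouredModule a x n) :
    (free.toFreeV N E).map a x n (free.mk T) = freeV.mk N T :=
  rfl

theorem freeV.mk_eq_of_eqvGen {a : List V} {x : V} {n : ℤ} {T T' : Tree E.toColouredModule a x n}
    (h : Relation.EqvGen (Tree.Step E N) T T') : freeV.mk N T = freeV.mk N T' := by
  induction h with
  | rel T T' h =>
    exact (Submodule.Quotient.eq _).2
      (GroupoidIdeal.subset_gen (freeVRelations N E) (.inr ⟨T, T', h, rfl⟩))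
  | refl => rfl
  | symm _ _ _ ih => exact ih.symm
  | trans _ _ _ _ _ ih ih' => exact ih.trans ih'

theorem freeV.mk_star {a : List V} {x : V} {n : ℤ} (T : Monomial E S a x n) :
    freeV.mk N (T.star N).1 = freeV.mk N T.1 :=
  (freeV.mk_eq_of_eqvGen T.star_mem_orbit).symm

/-- Passing to a representative of the same class is invisible in the free `V`-coloured operad,
whichever expression of `r` was chosen. -/
theorem IsStar.toFreeV {a : List V} {x : V} {n : ℤ} {r : (freeV N E).obj a x n}
    {ρ : (free E.toColouredModule).obj a x n} (h : IsStar N S r ρ) :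
    (free.toFreeV N E).map a x n ρ = r := by
  obtain ⟨l, rfl, rfl⟩ := h
  rw [Finsupp.sum, Finsupp.sum, map_sum]
  refine Finset.sum_congr rfl fun T _ => ?_
  rw [map_smul, free.toFreeV_mk, freeV.mk_star]

theorem edgeRelations_subset_ker (N : Subgroupoid V) (a : List V) (x : V) (n : ℤ) :
    edgeRelations N E S a x n ⊆ (free.toFreeV N E).ker.carrier a x n := by
  rintro _ ⟨c, b, y, p, q, φ, h, α, β, T, -, -, hT, rfl⟩
  rw [SetLike.mem_coe, Operad.Hom.mem_ker, map_sub,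
    free.comp_mk φ h _ _ (Tree.corolla_after (M := E.toColouredModule) α φ), ← hT,
    free.toFreeV_mk, free.toFreeV_mk, freeV.mk_star, sub_self]

/-- A quotient of the free `ob(V)`-coloured operad in which the relations `E_*²` hold is a quotient
of the free `V`-coloured operad. -/
theorem exists_freeV_desc (hfin : ∀ x : V, Finite ((y : V) × N.arrows x y))
    (hspan : ∀ c x n, Submodule.span K (S c x n) = ⊤)
    (hact : ∀ (c c' : List V) (x x' : V) (n : ℤ) (f : Homs c' c) (g : x ⟶ x'),
      ∀ e ∈ S c x n, E.act f g e ∈ S c' x' n)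
    (π : (free E.toColouredModule).Hom Q)
    (hπ : ∀ a x n, edgeRelations N E S a x n ⊆ π.ker.carrier a x n) :
    ∃ θ : (freeV N E).toOperad.Hom Q,
      ∀ a x n α, θ.map a x n ((free.toFreeV N E).map a x n α) = π.map a x n α := by
  refine ⟨Operad.Hom.desc (((formal E.toColouredModule).proj (Ideal.gen (Multilinear _))).trans π)
    (freeVIdeal N E).toIdeal
    (freeVIdeal_le (identifiesEdges_of_edgeRelations hfin hspan hact π hπ) ?_), ?_⟩
  · intro a x n ρ hρ
    rw [SetLike.mem_coe, Operad.Hom.mem_ker]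
    refine (congrArg (π.map a x n) ((Operad.proj_eq_zero _).2 (Ideal.subset_gen _ hρ))).trans ?_
    exact map_zero _
  · intro a x n α
    obtain ⟨α, rfl⟩ := Submodule.mkQ_surjective _ α
    rfl

theorem free.toFreeV_surjective (N : Subgroupoid V) (a : List V) (x : V) (n : ℤ) :
    Function.Surjective ((free.toFreeV N E).map a x n) := fun β => by
  obtain ⟨α, rfl⟩ := Submodule.mkQ_surjective _ β
  exact ⟨Submodule.Quotient.mk α, rfl⟩

theorem freeV_equivariant (N : Subgroupoid V) (E : GroupoidModule.{u, v, w} K V) :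
    (freeV N E).Equivariant :=
  (formalV_equivariant E).quotient (freeVIdeal N E)

end Comparison

end ShuffleOp

/-! ### The two isomorphisms. -/

open ShuffleOp in
theorem mainTheorem4 {K : Type k} [Field K] {V : Type u} [Groupoid.{v} V]
    (N : Subgroupoid V) (hN : ∀ (x : V) (g : x ⟶ x), g ∈ N.arrows x x)
    (hfin : ∀ x : V, Finite ((y : V) × N.arrows x y))
    (E : ShuffleOp.GroupoidModule.{u, v, w} K V)
    (S : ∀ c x n, Set (E.obj c x n))
    (hspan : ∀ c x n, Submodule.span K (S c x n) = ⊤)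
    (hact : ∀ (c c' : List V) (x x' : V) (n : ℤ) (f : ShuffleOp.Homs c' c) (g : x ⟶ x'),
      ∀ e ∈ S c x n, E.act f g e ∈ S c' x' n)
    [∀ a x n, LinearOrder (ShuffleOp.Monomial E S a x n)] :
    Nonempty ((ShuffleOp.freeV N E).toOperad.Iso
      ((ShuffleOp.free E.toColouredModule).quotient
        (ShuffleOp.Ideal.gen (ShuffleOp.edgeRelations N E S)))) ∧
    ∀ (R : ∀ a x n, Set ((ShuffleOp.freeV N E).obj a x n)),
      (∀ (a a' : List V) (x x' : V) (n : ℤ) (f : ShuffleOp.Homs a' a) (g : x ⟶ x'),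
        ∀ r ∈ R a x n, (ShuffleOp.freeV N E).act f g r ∈ Submodule.span K (R a' x' n)) →
      ∀ (star : ∀ a x n, (ShuffleOp.freeV N E).obj a x n →
          (ShuffleOp.free E.toColouredModule).obj a x n),
        (∀ a x n, ∀ r ∈ R a x n, ShuffleOp.IsStar N S r (star a x n r)) →
        Nonempty (((ShuffleOp.freeV N E).quotient (ShuffleOp.GroupoidIdeal.gen R)).toOperad.Iso
          ((ShuffleOp.free E.toColouredModule).quotient
            (ShuffleOp.Ideal.gen fun a x n =>
              ShuffleOp.edgeRelations N E S a x n ∪ star a x n '' R a x n))) := by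
  refine ⟨?_, fun R hR star hstar => ?_⟩
  · obtain ⟨θ, hθ⟩ := exists_freeV_desc hfin hspan hact
      ((free E.toColouredModule).proj (Ideal.gen (edgeRelations N E S)))
      (fun a x n ρ hρ => (Operad.proj_eq_zero _).2 (Ideal.subset_gen _ hρ))
    refine (free.toFreeV N E).nonempty_iso _ (free.toFreeV_surjective N)
      (Operad.proj_surjective (Ideal.gen (edgeRelations N E S)))
      fun a x n => le_antisymm (fun α hα => ?_) (fun α hα => ?_)
    · rw [Operad.Hom.mem_ker] at hα ⊢
      -- The projection factors through the free `V`-coloured operad by `θ`, so it kills whatever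
      -- vanishes there.
      rw [← hθ, hα, map_zero]
    · exact Ideal.gen_le _ (edgeRelations_subset_ker N) a x n ((Operad.proj_eq_zero _).1 hα)
  · let R' : ∀ a x n, Set ((free E.toColouredModule).obj a x n) := fun a x n =>
      edgeRelations N E S a x n ∪ star a x n '' R a x n
    obtain ⟨θ, hθ⟩ := exists_freeV_desc hfin hspan hact
      ((free E.toColouredModule).proj (Ideal.gen R'))
      (fun a x n ρ hρ => (Operad.proj_eq_zero _).2 (Ideal.subset_gen _ (.inl hρ)))
    -- Because the span of `R` is stable under `V`, it suffices that `θ` kills `R` itself; and `r`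
    -- is the image of `r_*`, which is zero in the target.
    have hθR : ∀ a x n, (GroupoidIdeal.gen R).carrier a x n ≤ θ.ker.carrier a x n := by
      intro a x n
      refine ((freeV_equivariant N E).gen_le (fun a a' x x' n f g r hr =>
        Submodule.span_le.2 (fun _ => Ideal.subset_gen (P := (freeV N E).toOperad) R)
          (hR a a' x x' n f g r hr)) a x n).trans (Ideal.gen_le _ (fun a x n r hr => ?_) a x n)
      rw [SetLike.mem_coe, Operad.Hom.mem_ker, ← (hstar a x n r hr).toFreeV, hθ]
      exact (Operad.proj_eq_zero _).2 (Ideal.subset_gen _ (.inr ⟨r, hr, rfl⟩))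
    let π := (free.toFreeV N E).trans
      ((freeV N E).toOperad.proj (GroupoidIdeal.gen R).toIdeal)
    have hmem : ∀ a x n (α : (free E.toColouredModule).obj a x n), π.map a x n α = 0 ↔
        (free.toFreeV N E).map a x n α ∈ (GroupoidIdeal.gen R).carrier a x n :=
      fun a x n α => Operad.proj_eq_zero (GroupoidIdeal.gen R).toIdeal
    refine π.nonempty_iso ((free E.toColouredModule).proj (Ideal.gen R'))
      (fun a x n => (Operad.proj_surjective _ a x n).comp (free.toFreeV_surjective N a x n))
      (Operad.proj_surjective _) fun a x n => le_antisymm (fun α hα => ?_) (fun α hα => ?_)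
    · rw [Operad.Hom.mem_ker] at hα ⊢
      rw [← hθ]
      exact hθR a x n ((hmem a x n α).1 hα)
    · refine Ideal.gen_le (R := R') π.ker ?_ a x n ((Operad.proj_eq_zero _).1 hα)
      rintro a x n ρ (hρ | ⟨r, hr, rfl⟩)
      · refine (hmem a x n ρ).2 ?_
        rw [(free.toFreeV N E).mem_ker.1 (edgeRelations_subset_ker N a x n hρ)]
        exact Submodule.zero_mem _
      · refine (hmem a x n _).2 ?_
        rw [(hstar a x n r hr).toFreeV]
        exact GroupoidIdeal.subset_gen R hr
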